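/- All graphs are finite, simple and undirected. Let $G$ be a graph with a total order $\le$ on $V(G)$ and let $r\ge 1$. An $r$-admissible path from $v$ to $x$ is a simple path of length at most $r$ such that $x<v$ and every internal vertex $w$ satisfies $w>v$. Let $\mathrm{pp}^r_{\le}(v)$ be the maximum number of $r$-admissible paths starting at $v$ that pairwise share no vertex other than $v$. The $r$-admissibility of $G$ is $\mathrm{adm}_r(G)=\min_{\le}\max_{v}\mathrm{pp}^r_{\le}(v)$, where the minimum is over all total orders of $V(G)$. A graph family $\mathcal F$ has universally bounded $r$-admissibility if there is a computable function $f:\mathbb N\to\mathbb N$ such that $\mathrm{adm}_r(G)\le f(r)$ for every $r\ge 1$ and every $G\in\mathcal F$. In the random neighbour oracle model, an algorithm receives the number $n\ge 1$ of vertices, a (rational) proximity parameter $\epsilon>0$, and access to a graph $G=([n],E)$ only through queries: a query is a vertex $v$, and the answer is an independent, uniformly random neighbour of $v$ (or the information that $v$ has no neighbour). A graph $G$ on $n$ vertices is $\epsilon$-far from a property $\mathcal P$ if at least $\epsilon n$ edges must be added to or removed from $G$ to obtain a graph in $\mathcal P$; if this is impossible, then $G$ is $\epsilon$-far from $\mathcal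 P$. A property $\mathcal P$ is testable with one-sided error on $\mathcal F$ if there is a randomized algorithm in this model such that, for all $n\ge 1$, all $\epsilon>0$ and every $G\in\mathcal F$ on vertex set $[n]$: it always halts; its number of queries is at most $q(\epsilon)$, where $q$ may depend on $\mathcal P$ and $\mathcal F$ but not on $n$ or $G$; it accepts with probability $1$ if $G\in\mathcal P$; and it rejects with probability at least $2/3$ if $G$ is $\epsilon$-far from $\mathcal P$. **Theorem.** Every graph family $\mathcal F$ with universally bounded $r$-admissibility is $H$-testable: for every graph $H$, the property of being $H$-free (containing no subgraph, induced or not, isomorphic to $H$) is testable with one-sided error on $\mathcal F$. -/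

import Mathlib

namespace GraphTesting

/-! ### Admissibility -/

section Admissibility

variable {V : Type*}

/-- `P` is an `r`-admissible path from `v` to `x` for the vertex order `L`: a simple path of length
at most `r` with `x < v`, all of whose internal vertices `w` satisfy `v < w`. -/
def IsAdmissiblePath (G : SimpleGraph V) (L : LinearOrder V) (r : ℕ) {v x : V}
    (P : G.Walk v x) : Prop :=
  P.IsPath ∧ P.length ≤ r ∧ L.lt x v ∧ ∀ w ∈ P.support, w ≠ v → w ≠ x → L.lt v w

/-- There is an admissible path packing of size `k` rooted at `v`: a collection of `k`
`r`-admissible paths starting at `v`, no two of which share a vertex other than `v`. -/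
def HasPathPacking (G : SimpleGraph V) (L : LinearOrder V) (r : ℕ) (v : V) (k : ℕ) : Prop :=
  ∃ (x : Fin k → V) (P : ∀ i, G.Walk v (x i)),
    (∀ i, IsAdmissiblePath G L r (P i)) ∧
      ∀ i j, i ≠ j → ∀ w, w ∈ (P i).support → w ∈ (P j).support → w = v

/-- The maximum size of an `r`-admissible path packing rooted at `v`. -/
noncomputable def packingNumber (G : SimpleGraph V) (L : LinearOrder V) (r : ℕ) (v : V) : ℕ∞ :=
  ⨆ (k : ℕ) (_ : HasPathPacking G L r v k), (k : ℕ∞)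

/-- The `r`-admissibility of the graph `G` ordered by `L`. -/
noncomputable def orderedAdm (G : SimpleGraph V) (L : LinearOrder V) (r : ℕ) : ℕ∞ :=
  ⨆ v : V, packingNumber G L r v

/-- The `r`-admissibility of `G`: the minimum over all orders of the vertices. -/
noncomputable def adm (G : SimpleGraph V) (r : ℕ) : ℕ∞ :=
  ⨅ L : LinearOrder V, orderedAdm G L r

end Admissibility

/-! ### Graph families and distance to a property -/

/-- A family (or a property) of finite graphs with vertex sets `{0, …, n - 1}`. -/
abbrev GraphFamily := ∀ n : ℕ, Set (SimpleGraph (Fin n))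

/-- `F` has universally bounded `r`-admissibility. -/
def UniversallyBoundedAdm (F : GraphFamily) : Prop :=
  ∃ f : ℕ → ℕ, Computable f ∧ ∀ r, 1 ≤ r → ∀ n, ∀ G ∈ F n, adm G r ≤ (f r : ℕ∞)

/-- The property of having no subgraph (not necessarily induced) isomorphic to `H`. -/
def HFreeness {k : ℕ} (H : SimpleGraph (Fin k)) : GraphFamily :=
  fun _ => {G | H.Free G}

/-- `G` is `ε`-far from `P`: at least `ε n` edges must be added or removed to obtain a graph
in `P`. -/
def IsFar (P : GraphFamily) (ε : ℝ) {n : ℕ} (G : SimpleGraph (Fin n)) : Prop :=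
  ∀ G' ∈ P n, ε * n ≤ ((symmDiff G.edgeSet G'.edgeSet).ncard : ℝ)

/-! ### Randomized algorithms with a random neighbour oracle -/

/-- One entry of a transcript: `inl (v, a)` records that the oracle was queried at the vertex `v`
and answered `a`; `inr c` records that the number `c` was drawn at random. -/
abbrev Entry := (ℕ × Option ℕ) ⊕ ℕ

/-- What an algorithm does next: `inl b` halts (accepting if `b = true`, rejecting if `b = false`),
`inr (inl v)` queries the oracle at the vertex `v`, and `inr (inr m)` draws a uniformly random
number from `{0, …, m}`. -/
abbrev Action := Bool ⊕ (ℕ ⊕ ℕ)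

/-- The input parameters of an algorithm: the number `n` of vertices and the numerator and
denominator `(a, b)` of the proximity parameter `ε = a / b`. -/
abbrev Params := ℕ × ℕ × ℕ

/-- A randomized oracle algorithm: the next action is a function of the input parameters and the
transcript so far (the most recent entry comes first). -/
abbrev OracleAlgorithm := Params × List Entry → Action

section Oracle

open Classical in
/-- The answer of the random neighbour oracle for `G` to the query `v`: a uniformly random
neighbour of `v`, and `none` if there is none. -/
noncomputable def oracleAnswer {n : ℕ} (G : SimpleGraph (Fin n)) (v : ℕ) : PMF (Option ℕ) :=
  if h : ∃ hv : v < n, (G.neighborFinset ⟨v, hv⟩).Nonempty then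
    (PMF.uniformOfFinset (G.neighborFinset ⟨v, h.1⟩) h.2).map fun u => some (u : ℕ)
  else PMF.pure none

/-- One step of the algorithm `T` on `G`: the distribution of the next transcript. A transcript on
which `T` has halted does not change. -/
noncomputable def step (T : OracleAlgorithm) (x : Params) {n : ℕ} (G : SimpleGraph (Fin n))
    (tr : List Entry) : PMF (List Entry) :=
  match T (x, tr) with
  | Sum.inl _ => PMF.pure tr
  | Sum.inr (Sum.inl v) => (oracleAnswer G v).map fun a => Sum.inl (v, a) :: tr
  | Sum.inr (Sum.inr m) =>
      (PMF.uniformOfFintype (Fin (m + 1))).map fun c => Sum.inr (c : ℕ) :: tr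

/-- The distribution of the transcript after `t` steps. -/
noncomputable def run (T : OracleAlgorithm) (x : Params) {n : ℕ} (G : SimpleGraph (Fin n)) :
    ℕ → PMF (List Entry)
  | 0 => PMF.pure []
  | t + 1 => (run T x G t).bind (step T x G)

/-- The number of oracle queries recorded in a transcript. -/
def queryCount (tr : List Entry) : ℕ := tr.countP Sum.isLeft

/-- `T` halts on `G` within a bounded number of steps, whatever the random outcomes are. -/
def Halts (T : OracleAlgorithm) (x : Params) {n : ℕ} (G : SimpleGraph (Fin n)) : Prop :=
  ∃ t, ∀ tr ∈ (run T x G t).support, ∃ b, T (x, tr) = Sum.inl b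

/-- `T` makes at most `q` oracle queries on `G`, whatever the random outcomes are. -/
def QueriesAtMost (T : OracleAlgorithm) (x : Params) {n : ℕ} (G : SimpleGraph (Fin n))
    (q : ℕ) : Prop :=
  ∀ t, ∀ tr ∈ (run T x G t).support, queryCount tr ≤ q

/-- The probability that `T` halts on `G` with verdict `b`. The probability that this has happened
within `t` steps is nondecreasing in `t`. -/
noncomputable def verdictProb (T : OracleAlgorithm) (x : Params) {n : ℕ}
    (G : SimpleGraph (Fin n)) (b : Bool) : ENNReal :=
  ⨆ t, ((run T x G t).map fun tr => T (x, tr)) (Sum.inl b)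

end Oracle

/-! ### Testability -/

/-- The property `P` is testable with one-sided error on the family `F`: there is a randomized
algorithm with random neighbour oracle access whose number of queries is bounded by a function `q`
of `ε` alone, which accepts every member of `F` in `P` with probability one, and rejects every
member of `F` that is `ε`-far from `P` with probability at least `2 / 3`. -/
def TestableOneSided (P F : GraphFamily) : Prop :=
  ∃ (T : OracleAlgorithm) (q : ℚ → ℕ), Computable T ∧
    ∀ n a b : ℕ, 0 < n → 0 < a → 0 < b → ∀ G ∈ F n,
      Halts T (n, a, b) G ∧
      QueriesAtMost T (n, a, b) G (q ((a : ℚ) / b)) ∧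
      (G ∈ P n → verdictProb T (n, a, b) G true = 1) ∧
      (IsFar P ((a : ℝ) / b) G → 2 / 3 ≤ verdictProb T (n, a, b) G false)

/-- The family `F` is `H`-testable: for every graph `H`, being `H`-free is testable with one-sided
error on `F`. -/
def HTestable (F : GraphFamily) : Prop :=
  ∀ (k : ℕ) (H : SimpleGraph (Fin k)), TestableOneSided (HFreeness H) F

end GraphTesting

/-! Bounded admissibility bounds weak reachability (`exists_weakReach_of_adm_le`): for a suitable
ranking, each vertex v has a set W v of size at most a constant M containing the end of every path
from v of length at most k + 1 whose end has minimum rank on the path. Here k is the number of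
vertices of H.

If G is far from H-free, greedy deletion gives linearly many edge-disjoint copies of H, and some
colouring makes a constant fraction of them colourful. The cleaning (`exists_cleaning`) marks few
edges, namely those leading to a sparse set of useful guesses. Hence some colourful copy φ avoids
all marked edges, and every set of guesses that matters for φ is dense.

The tester need not find φ itself. Let D be a component of the part of H ranked above h that
contains a neighbour of h. The vertices outside D adjacent to D are weakly reachable from h, so
their images lie in W (φ h). Only boundedly many boundary conditions for D thus arise at φ h, and
the cleaning can treat each of them. A random neighbour of φ h then starts, with probability at
least 1/κ, a substitute for D with the same boundary. Lower neighbours of h are guessed exactly,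
because φ h has degree at most κ if there are any. Substitutes for different components fit
together, as H has no edges between these components and the colours keep them disjoint. Induction
over parts (`IsRobustCopy.findsAbove`) turns this into `CanReach`: boundedly many guesses, each
lucky with probability at least 1/κ.

The algorithm makes these guesses blindly, and constantly many rounds succeed with probability 2/3
(`two_thirds_le_prob`). It rejects only after seeing a copy of H, so the error is one-sided. -/

namespace GraphTesting

/-! ### Weak reachability -/

section WeakReachability

variable {V : Type*}

/-- The part of a path up to the first vertex below `a`. -/
lemma exists_walk_to_first_lt [LinearOrder V] {G : SimpleGraph V} {x : V} (a : V) (hx : x < a) :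
    ∀ {v : V} (P : G.Walk v x), P.IsPath → a ≤ v →
      ∃ (y : V) (Q : G.Walk v y), Q.IsPath ∧ Q.length ≤ P.length ∧ y < a ∧
        Q.support ⊆ P.support ∧ ∀ w ∈ Q.support, w ≠ y → a ≤ w
  | _, .nil, _, hv => absurd hx (not_lt.2 hv)
  | v, .cons (v := u) h P, hP, hv => by
    rw [SimpleGraph.Walk.cons_isPath_iff] at hP
    by_cases hu : u < a
    · refine ⟨u, .cons h .nil, ?_, by simp, hu, ?_, ?_⟩
      · simp [h.ne]
      · intro w hw
        simp only [SimpleGraph.Walk.support_cons, SimpleGraph.Walk.support_nil, List.mem_cons,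
          List.not_mem_nil, or_false] at hw ⊢
        rcases hw with rfl | rfl
        · exact Or.inl rfl
        · exact Or.inr P.start_mem_support
      · intro w hw hwu
        simp only [SimpleGraph.Walk.support_cons, SimpleGraph.Walk.support_nil, List.mem_cons,
          List.not_mem_nil, or_false] at hw
        rcases hw with rfl | rfl
        · exact hv
        · exact absurd rfl hwu
    · obtain ⟨y, Q, hQ, hlen, hy, hsub, hge⟩ :=
        exists_walk_to_first_lt a hx P hP.1 (not_lt.1 hu)
      refine ⟨y, .cons h Q, ?_, by simpa using hlen, hy, ?_, ?_⟩
      · rw [SimpleGraph.Walk.cons_isPath_iff]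
        exact ⟨hQ, fun hm => hP.2 (hsub hm)⟩
      · intro w hw
        simp only [SimpleGraph.Walk.support_cons, List.mem_cons] at hw ⊢
        exact hw.imp id fun h => hsub h
      · intro w hw hwy
        simp only [SimpleGraph.Walk.support_cons, List.mem_cons] at hw
        rcases hw with rfl | hw
        · exact hv
        · exact hge w hw hwy

/-- A bound on the admissible path packings at `v` yields a small set that meets every admissible
path starting at `v`. -/
lemma exists_hitting_finset [DecidableEq V] (G : SimpleGraph V) (L : LinearOrder V) (r p : ℕ) (v : V)
    (hp : ∀ k, HasPathPacking G L r v k → k ≤ p) :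
    ∃ Z : Finset V, Z.card ≤ p * r ∧ ∀ (y : V) (Q : G.Walk v y), IsAdmissiblePath G L r Q →
      ∃ z ∈ Q.support, z ≠ v ∧ z ∈ Z := by
  classical
  have h0 : HasPathPacking G L r v 0 := ⟨fun i => i.elim0, fun i => i.elim0, fun i => i.elim0,
    fun i => i.elim0⟩
  have hk : HasPathPacking G L r v (Nat.findGreatest (HasPathPacking G L r v) p) :=
    Nat.findGreatest_spec (Nat.zero_le p) h0
  have hmax : ¬ HasPathPacking G L r v (Nat.findGreatest (HasPathPacking G L r v) p + 1) := by
    intro h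
    have h1 := Nat.le_findGreatest (hp _ h) h
    omega
  have hle : Nat.findGreatest (HasPathPacking G L r v) p ≤ p := Nat.findGreatest_le p
  generalize Nat.findGreatest (HasPathPacking G L r v) p = k at hk hmax hle
  obtain ⟨x, P, hadm, hdisj⟩ := hk
  -- The hitting set consists of all vertices other than `v` on a largest packing; a path of length
  -- at most `r` contributes at most `r` of them.
  refine ⟨Finset.univ.biUnion fun i => (P i).support.toFinset.erase v, ?_, ?_⟩
  · calc _ ≤ ∑ i : Fin k, ((P i).support.toFinset.erase v).card := Finset.card_biUnion_le
      _ ≤ ∑ _i : Fin k, r := by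
        refine Finset.sum_le_sum fun i _ => ?_
        rw [Finset.card_erase_of_mem (by simp)]
        have h1 := (P i).support.toFinset_card_le
        rw [SimpleGraph.Walk.length_support] at h1
        have h2 := (hadm i).2.1
        omega
      _ = k * r := by simp
      _ ≤ p * r := Nat.mul_le_mul_right r hle
  · intro y Q hQ
    by_contra! hcon
    have key : ∀ i w, w ∈ Q.support → w ∈ (P i).support → w = v := by
      intro i w hw hwi
      by_contra hne
      exact hcon w hw hne (by simp only [Finset.mem_biUnion]; exact ⟨i, by simp, by simp [hne, hwi]⟩)
    -- A path that misses the hitting set would enlarge the packing.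
    refine hmax ⟨Fin.cons y x, Fin.cons (α := fun i => G.Walk v (Fin.cons (α := fun _ => V) y x i))
      Q P, ?_, ?_⟩
    · intro i
      refine Fin.cases ?_ (fun i => ?_) i
      · exact hQ
      · exact hadm i
    · intro i j
      refine Fin.cases ?_ (fun i => ?_) i
      · refine Fin.cases ?_ (fun j => ?_) j
        · intro h; exact absurd rfl h
        · intro _ w hw hw'
          exact key j w hw hw'
      · refine Fin.cases ?_ (fun j => ?_) j
        · intro _ w hw hw'
          exact key i w hw' hw
        · intro hij w hw hw'
          exact hdisj i j (fun h => hij (by rw [h])) w hw hw'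

/-- The vertices reached from `v` in at most `i` jumps along `Z`. -/
def jumpSet [DecidableEq V] (Z : V → Finset V) : ℕ → V → Finset V
  | 0, v => {v}
  | i + 1, v => insert v ((Z v).biUnion (jumpSet Z i))

lemma self_mem_jumpSet [DecidableEq V] (Z : V → Finset V) (i : ℕ) (v : V) : v ∈ jumpSet Z i v := by
  cases i <;> simp [jumpSet]

lemma card_jumpSet_le [DecidableEq V] (Z : V → Finset V) (s : ℕ) (hZ : ∀ v, (Z v).card ≤ s) (i : ℕ)
    (v : V) : (jumpSet Z i v).card ≤ (s + 1) ^ i := by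
  induction i generalizing v with
  | zero => simp [jumpSet]
  | succ i ih =>
    calc _ ≤ ((Z v).biUnion (jumpSet Z i)).card + 1 := Finset.card_insert_le _ _
      _ ≤ (Z v).card * (s + 1) ^ i + 1 :=
        Nat.add_le_add_right (Finset.card_biUnion_le_card_mul _ _ _ fun u _ => ih u) 1
      _ ≤ s * (s + 1) ^ i + (s + 1) ^ i :=
        Nat.add_le_add (Nat.mul_le_mul_right _ (hZ v)) (Nat.one_le_pow _ _ (Nat.succ_pos s))
      _ = (s + 1) ^ (i + 1) := by ring

/-- The path up to its first vertex below `v` is admissible, hence meets `Z v` in some z ≠ v.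
Jumping to z leaves a strictly shorter path with the same minimum `x`. -/
lemma mem_jumpSet_of_path [DecidableEq V] [L : LinearOrder V] {G : SimpleGraph V} {r : ℕ}
    {Z : V → Finset V}
    (hZ : ∀ (v y : V) (Q : G.Walk v y), IsAdmissiblePath G L r Q →
      ∃ z ∈ Q.support, z ≠ v ∧ z ∈ Z v)
    {x : V} (i : ℕ) (hi : i ≤ r) {v : V} (P : G.Walk v x) (hP : P.IsPath) (hlen : P.length ≤ i)
    (hx : ∀ y ∈ P.support, x ≤ y) : x ∈ jumpSet Z i v := by
  induction i generalizing v with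
  | zero =>
    cases P with
    | nil => simp [jumpSet]
    | cons h P => simp at hlen
  | succ i ih =>
    by_cases hvx : x = v
    · subst hvx; exact self_mem_jumpSet _ _ _
    have hlt : x < v := lt_of_le_of_ne (hx v P.start_mem_support) hvx
    obtain ⟨y, Q, hQ, hQlen, hy, hsub, hge⟩ := exists_walk_to_first_lt v hlt P hP le_rfl
    obtain ⟨z, hz, hzv, hzZ⟩ := hZ v y Q ⟨hQ, by omega, hy, fun w hw hwv hwy =>
      lt_of_le_of_ne (hge w hw hwy) (Ne.symm hwv)⟩
    have hzP := hsub hz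
    have := SimpleGraph.Walk.length_dropUntil_lt_length hzP hzv
    have hmem := ih (by omega) (P.dropUntil z hzP) (hP.dropUntil hzP) (by omega)
      fun w hw => hx w (P.support_dropUntil_subset_support hzP hw)
    simp only [jumpSet, Finset.mem_insert, Finset.mem_biUnion]
    exact Or.inr ⟨z, hzZ, hmem⟩

/-- Bounded admissibility bounds the weak reachability sets of a suitable ranking. -/
theorem exists_weakReach_of_adm_le [Fintype V] [DecidableEq V] (G : SimpleGraph V) (r p : ℕ)
    (h : adm G r ≤ (p : ℕ∞)) :
    ∃ (ρ : V → ℕ) (W : V → Finset V), Function.Injective ρ ∧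
      (∀ v, (W v).card ≤ (p * r + 1) ^ r) ∧
      ∀ (v x : V) (P : G.Walk v x), P.IsPath → P.length ≤ r → (∀ y ∈ P.support, ρ x ≤ ρ y) →
        x ∈ W v := by
  -- A strict bound on the infimum produces an order directly, without showing that the infimum is
  -- attained.
  have hlt : adm G r < ((p + 1 : ℕ) : ℕ∞) := lt_of_le_of_lt h (by exact_mod_cast Nat.lt_succ_self p)
  obtain ⟨L, hL⟩ := iInf_lt_iff.1 hlt
  have hp : ∀ v k, HasPathPacking G L r v k → k ≤ p := by
    intro v k hk
    have h1 : (k : ℕ∞) ≤ packingNumber G L r v := le_iSup₂ (f := fun (k : ℕ) _ => (k : ℕ∞)) k hk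
    have h2 : packingNumber G L r v ≤ orderedAdm G L r := le_iSup (fun v => packingNumber G L r v) v
    have h3 : (k : ℕ∞) < ((p + 1 : ℕ) : ℕ∞) := lt_of_le_of_lt (h1.trans h2) hL
    have h4 : k < p + 1 := by exact_mod_cast h3
    omega
  choose Z hZcard hZ using fun v => exists_hitting_finset G L r p v (hp v)
  -- Counting smaller vertices replaces the order by a numerical ranking.
  have hmono : StrictMono fun v : V => (Finset.univ.filter (· < v)).card := by
    intro a b hab
    refine Finset.card_lt_card ?_
    rw [Finset.ssubset_iff_of_subset]
    · exact ⟨a, by simpa using hab, by simp⟩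
    · intro c hc
      simp only [Finset.mem_filter, Finset.mem_univ, true_and] at hc ⊢
      exact hc.trans hab
  refine ⟨fun v => (Finset.univ.filter (· < v)).card, fun v => jumpSet Z r v, hmono.injective,
    fun v => card_jumpSet_le Z _ hZcard r v, ?_⟩
  intro v x P hP hlen hx
  exact mem_jumpSet_of_path hZ r le_rfl P hP hlen fun y hy => hmono.le_iff_le.1 (hx y hy)

end WeakReachability

/-! ### Exploration states and reachable goals -/

section Exploration

variable {V : Type*}

/-- What an exploration knows: some vertices and some edges. -/
abbrev Knowledge (V : Type*) := Set V × Set (Sym2 V)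

open Classical in
/-- The set of neighbours of `v`. -/
noncomputable def nbrs [Fintype V] (G : SimpleGraph V) (v : V) : Finset V :=
  Finset.univ.filter (G.Adj v)

@[simp] lemma mem_nbrs [Fintype V] {G : SimpleGraph V} {u v : V} : u ∈ nbrs G v ↔ G.Adj v u := by
  simp [nbrs]

/-- The goal can be reached with at most `j` lucky guesses. A guess is either a uniformly random
vertex or a uniformly random neighbour of a known vertex, and it is lucky when it lies in a chosen
set of density at least `1 / κ`. -/
def CanReach [Fintype V] (G : SimpleGraph V) (κ : ℕ) (goal : Knowledge V → Prop) :
    ℕ → Knowledge V → Prop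
  | 0, s => goal s
  | j + 1, s => goal s ∨
      (∃ S : Finset V, Fintype.card V ≤ κ * S.card ∧
        ∀ u ∈ S, CanReach G κ goal j (insert u s.1, s.2)) ∨
      ∃ v ∈ s.1, ∃ S ⊆ nbrs G v, S.Nonempty ∧ (nbrs G v).card ≤ κ * S.card ∧
        ∀ u ∈ S, CanReach G κ goal j (insert u s.1, insert s(v, u) s.2)

variable [Fintype V] {G : SimpleGraph V} {κ : ℕ} {goal goal' : Knowledge V → Prop}

lemma CanReach.of_goal {s : Knowledge V} (h : goal s) (j : ℕ) : CanReach G κ goal j s := by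
  cases j with
  | zero => exact h
  | succ j => exact Or.inl h

lemma CanReach.succ {j : ℕ} {s : Knowledge V} (h : CanReach G κ goal j s) :
    CanReach G κ goal (j + 1) s := by
  induction j generalizing s with
  | zero => exact Or.inl h
  | succ j ih =>
    rcases h with h | ⟨S, hS, h⟩ | ⟨v, hv, S, hSv, hne, hS, h⟩
    · exact Or.inl h
    · exact Or.inr (Or.inl ⟨S, hS, fun u hu => ih (h u hu)⟩)
    · exact Or.inr (Or.inr ⟨v, hv, S, hSv, hne, hS, fun u hu => ih (h u hu)⟩)

lemma CanReach.mono_steps {j j' : ℕ} {s : Knowledge V} (h : CanReach G κ goal j s) (hj : j ≤ j') :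
    CanReach G κ goal j' s := by
  induction hj with
  | refl => exact h
  | step _ ih => exact ih.succ

lemma CanReach.mono_state (hg : Monotone goal) {j : ℕ} {s s' : Knowledge V}
    (h : CanReach G κ goal j s) (hs : s ≤ s') : CanReach G κ goal j s' := by
  induction j generalizing s s' with
  | zero => exact hg hs h
  | succ j ih =>
    rcases h with h | ⟨S, hS, h⟩ | ⟨v, hv, S, hSv, hne, hS, h⟩
    · exact Or.inl (hg hs h)
    · exact Or.inr (Or.inl ⟨S, hS, fun u hu => ih (h u hu) ⟨Set.insert_subset_insert hs.1, hs.2⟩⟩)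
    · exact Or.inr (Or.inr ⟨v, hs.1 hv, S, hSv, hne, hS, fun u hu =>
        ih (h u hu) ⟨Set.insert_subset_insert hs.1, Set.insert_subset_insert hs.2⟩⟩)

/-- Sequential composition: knowledge only grows along guesses, so the second search need only start
from states above `s`. -/
lemma CanReach.bind {j j' : ℕ} {s : Knowledge V} (h : CanReach G κ goal j s)
    (h' : ∀ s', s ≤ s' → goal s' → CanReach G κ goal' j' s') :
    CanReach G κ goal' (j + j') s := by
  induction j generalizing s with
  | zero => simpa using h' s le_rfl h
  | succ j ih =>
    rcases h with h | ⟨S, hS, h⟩ | ⟨v, hv, S, hSv, hne, hS, h⟩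
    · exact (h' s le_rfl h).mono_steps (by omega)
    · rw [Nat.succ_add]
      refine Or.inr (Or.inl ⟨S, hS, fun u hu => ih (h u hu) fun s' hs' => h' s' (le_trans ?_ hs')⟩)
      exact ⟨Set.subset_insert _ _, le_rfl⟩
    · rw [Nat.succ_add]
      refine Or.inr (Or.inr ⟨v, hv, S, hSv, hne, hS, fun u hu =>
        ih (h u hu) fun s' hs' => h' s' (le_trans ?_ hs')⟩)
      exact ⟨Set.subset_insert _ _, Set.subset_insert _ _⟩

lemma CanReach.mono_goal {j : ℕ} {s : Knowledge V} (h : CanReach G κ goal j s)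
    (h' : ∀ s', s ≤ s' → goal s' → goal' s') : CanReach G κ goal' j s :=
  h.bind (j' := 0) fun s' hs hg => h' s' hs hg

/-- The goals are pursued one after another; monotonicity preserves those already attained. -/
lemma CanReach.forall_finset {ι : Type*} [DecidableEq ι] {goals : ι → Knowledge V → Prop} {j : ℕ}
    {s : Knowledge V} (t : Finset ι) (hmono : ∀ i ∈ t, Monotone (goals i))
    (h : ∀ i ∈ t, ∀ s', s ≤ s' → CanReach G κ (goals i) j s') :
    CanReach G κ (fun s' => ∀ i ∈ t, goals i s') (t.card * j) s := by
  induction t using Finset.induction_on with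
  | empty => exact .of_goal (by simp) _
  | insert a t ha ih =>
    rw [Finset.card_insert_of_notMem ha, Nat.succ_mul]
    refine (ih (fun i hi => hmono i (Finset.mem_insert_of_mem hi))
      fun i hi => h i (Finset.mem_insert_of_mem hi)).bind fun s' hs' hall => ?_
    refine (h a (Finset.mem_insert_self a t) s' hs').mono_goal fun s'' hs'' hga i hi => ?_
    rcases Finset.mem_insert.1 hi with rfl | hi
    · exact hga
    · exact hmono i (Finset.mem_insert_of_mem hi) hs'' (hall i hi)

end Exploration

/-! ### Components inside a set of vertices -/

section Components

variable {K : Type*} [Fintype K] {H : SimpleGraph K}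

open Classical in
/-- The vertices joined to `g` by a walk inside `U`. -/
noncomputable def compIn (H : SimpleGraph K) (U : Set K) (g : K) : Finset K :=
  Finset.univ.filter fun x => ∃ p : H.Walk g x, ∀ y ∈ p.support, y ∈ U

lemma mem_compIn {U : Set K} {g x : K} :
    x ∈ compIn H U g ↔ ∃ p : H.Walk g x, ∀ y ∈ p.support, y ∈ U := by
  simp [compIn]

lemma self_mem_compIn {U : Set K} {g : K} (hg : g ∈ U) : g ∈ compIn H U g :=
  mem_compIn.2 ⟨.nil, by simpa using hg⟩

lemma mem_of_mem_compIn {U : Set K} {g x : K} (hx : x ∈ compIn H U g) : x ∈ U := by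
  obtain ⟨p, hp⟩ := mem_compIn.1 hx
  exact hp x p.end_mem_support

lemma compIn_subset_of_mem {U U' : Set K} (hU : U' ⊆ U) {g x : K} (hx : x ∈ compIn H U g) :
    compIn H U' x ⊆ compIn H U g := by
  intro y hy
  obtain ⟨p, hp⟩ := mem_compIn.1 hx
  obtain ⟨q, hq⟩ := mem_compIn.1 hy
  refine mem_compIn.2 ⟨p.append q, fun z hz => ?_⟩
  rcases (SimpleGraph.Walk.mem_support_append_iff _ _).1 hz with hz | hz
  · exact hp z hz
  · exact hU (hq z hz)

lemma mem_compIn_symm {U : Set K} {g x : K} (hx : x ∈ compIn H U g) : g ∈ compIn H U x := by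
  obtain ⟨p, hp⟩ := mem_compIn.1 hx
  exact mem_compIn.2 ⟨p.reverse, fun z hz => hp z (by simpa using hz)⟩

lemma compIn_eq_of_mem {U : Set K} {g x : K} (hx : x ∈ compIn H U g) :
    compIn H U x = compIn H U g :=
  (compIn_subset_of_mem le_rfl hx).antisymm (compIn_subset_of_mem le_rfl (mem_compIn_symm hx))

lemma adj_mem_compIn {U : Set K} {g x y : K} (hx : x ∈ compIn H U g) (hxy : H.Adj x y)
    (hy : y ∈ U) : y ∈ compIn H U g :=
  compIn_subset_of_mem le_rfl hx
    (mem_compIn.2 ⟨.cons hxy .nil, by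
      intro z hz
      simp only [SimpleGraph.Walk.support_cons, SimpleGraph.Walk.support_nil, List.mem_cons,
        List.not_mem_nil, or_false] at hz
      rcases hz with rfl | rfl
      exacts [mem_of_mem_compIn hx, hy]⟩)

/-- A walk inside `U` from `g` to `b` must cross the boundary of `D`, and each of its vertices stays
in the component of `g`. -/
lemma exists_exit_compIn {U : Set K} {g b : K} (hb : b ∈ compIn H U g) (D : Set K)
    (hg : g ∈ D) (hbD : b ∉ D) : ∃ x ∈ D, ∃ y ∉ D, y ∈ compIn H U g ∧ H.Adj x y := by
  classical
  obtain ⟨p, hp⟩ := mem_compIn.1 hb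
  obtain ⟨d, hd, h1, h2⟩ := p.exists_boundary_dart D hg hbD
  have hsub : ∀ y ∈ p.support, y ∈ compIn H U g := by
    intro y hy
    exact mem_compIn.2 ⟨p.takeUntil y hy, fun z hz =>
      hp z (p.support_takeUntil_subset_support hy hz)⟩
  exact ⟨d.fst, h1, d.snd, h2, hsub _ (p.dart_snd_mem_support_of_mem_darts hd), d.adj⟩

lemma lt_of_mem_compIn {σ : K → ℕ} {h g x : K} (hx : x ∈ compIn H {y | σ h < σ y} g) :
    σ h < σ x := by
  have : x ∈ {y | σ h < σ y} := mem_of_mem_compIn hx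
  exact this

lemma le_of_mem_compIn {σ : K → ℕ} {h g x : K} (hx : x ∈ compIn H {y | σ h ≤ σ y} g) :
    σ h ≤ σ x := by
  have : x ∈ {y | σ h ≤ σ y} := mem_of_mem_compIn hx
  exact this

lemma compIn_le_subset_compIn_lt {σ : K → ℕ} {h g x : K}
    (hx : x ∈ compIn H {y | σ h < σ y} g) :
    compIn H {y | σ x ≤ σ y} x ⊆ compIn H {y | σ h < σ y} g := by
  refine compIn_subset_of_mem (fun y hy => ?_) hx
  rw [Set.mem_ofPred_eq] at hy ⊢
  exact lt_of_lt_of_le (lt_of_mem_compIn hx) hy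

lemma compIn_lt_subset_compIn_le {σ : K → ℕ} {h g x : K}
    (hx : x ∈ compIn H {y | σ h ≤ σ y} g) :
    compIn H {y | σ h < σ y} x ⊆ compIn H {y | σ h ≤ σ y} g :=
  compIn_subset_of_mem (fun y hy => by rw [Set.mem_ofPred_eq] at hy ⊢; exact hy.le) hx

/-- Once shortened to a path, the walk never returns to `h`, so by injectivity of `σ` everything
after its first step lies strictly above `h`. -/
lemma exists_adj_mem_compIn {σ : K → ℕ} (hσ : Function.Injective σ) {h x : K}
    (hx : x ∈ compIn H {y | σ h ≤ σ y} h) (hxh : x ≠ h) :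
    ∃ g, H.Adj h g ∧ σ h < σ g ∧ x ∈ compIn H {y | σ h < σ y} g := by
  classical
  obtain ⟨p, hp⟩ := mem_compIn.1 hx
  have hsub : ∀ y ∈ p.bypass.support, σ h ≤ σ y := fun y hy => hp y (p.support_bypass_subset_support hy)
  have hpath := p.bypass_isPath
  cases hq : p.bypass with
  | nil => exact absurd rfl hxh
  | @cons _ g _ hadj q =>
    rw [hq] at hsub hpath
    rw [SimpleGraph.Walk.cons_isPath_iff] at hpath
    have hlt : ∀ y ∈ q.support, σ h < σ y := fun y hy =>
      lt_of_le_of_ne (hsub y (by simp [hy])) fun he => hpath.2 (hσ he ▸ hy)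
    exact ⟨g, hadj, hlt g q.start_mem_support, mem_compIn.2 ⟨q, hlt⟩⟩

end Components

/-! ### Finding coloured partial copies -/

section PartialCopies

variable {V K : Type*}

/-- A properly coloured copy of the part of `H` touching `C`, with boundary prescribed by `ψ`, is
known. -/
def Found (H : SimpleGraph K) (χ : V → K) (C : Finset K) (ψ : K → V) (s : Knowledge V) : Prop :=
  ∃ φ : K → V, (∀ x ∈ C, χ (φ x) = x) ∧ (∀ x ∈ C, ∀ y ∉ C, H.Adj x y → φ y = ψ y) ∧
    ∀ x ∈ C, ∀ y, H.Adj x y → φ x ∈ s.1 ∧ φ y ∈ s.1 ∧ s(φ x, φ y) ∈ s.2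

lemma monotone_found (H : SimpleGraph K) (χ : V → K) (C : Finset K) (ψ : K → V) :
    Monotone (Found H χ C ψ) := by
  rintro s s' hs ⟨φ, h1, h2, h3⟩
  exact ⟨φ, h1, h2, fun x hx y hxy => ⟨hs.1 (h3 x hx y hxy).1, hs.1 (h3 x hx y hxy).2.1,
    hs.2 (h3 x hx y hxy).2.2⟩⟩

/-- Only the values of `ψ` on outside neighbours of `C` matter. This allows exchanging the full copy
for a boundary function with all values in a weak reachability set. -/
lemma Found.congr {H : SimpleGraph K} {χ : V → K} {C : Finset K} {ψ ψ' : K → V} {s : Knowledge V}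
    (h : Found H χ C ψ s) (hψ : ∀ x ∈ C, ∀ y ∉ C, H.Adj x y → ψ y = ψ' y) :
    Found H χ C ψ' s := by
  obtain ⟨φ, h1, h2, h3⟩ := h
  exact ⟨φ, h1, fun x hx y hy hxy => (h2 x hx y hy hxy).trans (hψ x hx y hy hxy), h3⟩

/-- The number of lucky guesses allowed for finding a part with `s` of the `k` vertices. -/
def budget (k : ℕ) : ℕ → ℕ
  | 0 => 0
  | s + 1 => (s + 1) * (k * (1 + budget k s))

/-- The factors count at most `s` searches above successively lower vertices, each treating at most
`k` neighbours at the cost of one guess and a search in a part with fewer than `s` vertices. -/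
lemma budget_eq (k : ℕ) {s : ℕ} (hs : 0 < s) : budget k s = s * (k * (1 + budget k (s - 1))) := by
  cases s with
  | zero => omega
  | succ s => rfl

lemma monotone_budget (k : ℕ) : Monotone (budget k) := by
  refine monotone_nat_of_le_succ fun s => ?_
  induction s with
  | zero => simp [budget]
  | succ s ih =>
    change (s + 1) * (k * (1 + budget k s)) ≤ (s + 2) * (k * (1 + budget k (s + 1)))
    gcongr
    omega

/-- Parts above `h` and edges below `h` combine to the part with minimum `h`. -/
lemma found_above [Fintype K] {H : SimpleGraph K} {χ : V → K} {φ : K → V} {σ : K → ℕ}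
    (hσ : Function.Injective σ) {h : K} (hcol : χ (φ h) = h) {s : Knowledge V} (hs : φ h ∈ s.1)
    (hup : ∀ g, H.Adj h g → σ h < σ g → Found H χ (compIn H {y | σ h < σ y} g) φ s)
    (hdown : ∀ g, H.Adj h g → σ g < σ h → φ g ∈ s.1 ∧ s(φ h, φ g) ∈ s.2) :
    Found H χ (compIn H {y | σ h ≤ σ y} h) φ s := by
  classical
  -- Choosing one map per vertex set, with `φ` as a dummy value, ensures that all vertices of a
  -- component use the same map.
  have hparts : ∀ D : Finset K, ∃ f : K → V, Found H χ D φ s →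
      (∀ x ∈ D, χ (f x) = x) ∧ (∀ x ∈ D, ∀ y ∉ D, H.Adj x y → f y = φ y) ∧
      ∀ x ∈ D, ∀ y, H.Adj x y → f x ∈ s.1 ∧ f y ∈ s.1 ∧ s(f x, f y) ∈ s.2 := by
    intro D
    by_cases hD : Found H χ D φ s
    · obtain ⟨f, hf⟩ := hD
      exact ⟨f, fun _ => hf⟩
    · exact ⟨φ, fun h => absurd h hD⟩
  choose F hF using hparts
  let part : K → Finset K := compIn H {y | σ h < σ y}
  have hpart : ∀ x, x ∈ compIn H {y | σ h ≤ σ y} h → x ≠ h →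
      Found H χ (part x) φ s ∧ x ∈ part x := by
    intro x hx hxh
    obtain ⟨g, hg, hlt, hxg⟩ := exists_adj_mem_compIn hσ hx hxh
    have := compIn_eq_of_mem hxg
    simp only [part, this]
    exact ⟨hup g hg hlt, hxg⟩
  have hnot : ∀ x, h ∉ part x := fun x hx => lt_irrefl (σ h) (lt_of_mem_compIn hx)
  have hself : h ∈ compIn H {y | σ h ≤ σ y} h := self_mem_compIn (le_refl (σ h))
  have hsucc : ∀ y, H.Adj h y → σ h < σ y → y ∈ compIn H {y | σ h ≤ σ y} h := fun y hy hlt =>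
    adj_mem_compIn hself hy (le_of_lt hlt)
  have hpred : ∀ y, y ≠ h → y ∈ compIn H {y | σ h ≤ σ y} h → σ h < σ y := fun y hy hyC =>
    lt_of_le_of_ne (le_of_mem_compIn hyC) fun he => hy (hσ he).symm
  -- The glued map keeps `h` in place, uses the substitute found for each component above `h`, and
  -- agrees with `φ` outside.
  refine ⟨fun x => if x = h then φ h else if x ∈ compIn H {y | σ h ≤ σ y} h then F (part x) x
    else φ x, ?_, ?_, ?_⟩
  · intro x hx
    by_cases hxh : x = h
    · simp [hxh, hcol]
    · simp only [hxh, if_false, hx, if_true]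
      obtain ⟨h1, h2⟩ := hpart x hx hxh
      exact (hF _ h1).1 x h2
  · intro x _ y hy _
    have hyh : y ≠ h := fun he => hy (he ▸ hself)
    simp [hyh, hy]
  · have hedge : ∀ x ∈ compIn H {y | σ h ≤ σ y} h, x ≠ h → H.Adj x h →
        F (part x) x ∈ s.1 ∧ φ h ∈ s.1 ∧ s(F (part x) x, φ h) ∈ s.2 := by
      intro x hx hxh hadj
      obtain ⟨h1, h2⟩ := hpart x hx hxh
      obtain ⟨-, hb, hk⟩ := hF _ h1
      have := hk x h2 h hadj
      rwa [hb x h2 h (hnot x) hadj] at this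
    intro x hx y hxy
    by_cases hxh : x = h
    · subst hxh
      have hyx : y ≠ x := hxy.ne'
      simp only [if_true, hyx, if_false]
      rcases lt_trichotomy (σ x) (σ y) with hlt | he | hlt
      · have hyC := hsucc y hxy hlt
        simp only [hyC, if_true]
        obtain ⟨h1, h2, h3⟩ := hedge y hyC hyx hxy.symm
        exact ⟨h2, h1, by rwa [Sym2.eq_swap]⟩
      · exact absurd (hσ he).symm hyx
      · have hyC : y ∉ compIn H {y | σ x ≤ σ y} x := fun hc =>
          absurd (le_of_mem_compIn hc) (not_le.2 hlt)
        simp only [hyC, if_false]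
        exact ⟨hs, hdown y hxy hlt⟩
    · simp only [hxh, if_false, hx, if_true]
      by_cases hyh : y = h
      · subst hyh
        simpa using hedge x hx hxh hxy
      · simp only [hyh, if_false]
        obtain ⟨h1, h2⟩ := hpart x hx hxh
        obtain ⟨-, hb, hk⟩ := hF _ h1
        by_cases hyC : y ∈ compIn H {y | σ h ≤ σ y} h
        · simp only [hyC, if_true]
          -- No edge joins two different components above `h`, so one substitute handles both ends.
          have hyp : y ∈ part x := adj_mem_compIn h2 hxy (hpred y hyh hyC)
          have : part y = part x := compIn_eq_of_mem hyp
          rw [this]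
          exact hk x h2 y hxy
        · simp only [hyC, if_false]
          have hyp : y ∉ part x := fun hyp =>
            hyC (adj_mem_compIn hx hxy (le_of_lt (lt_of_mem_compIn hyp)))
          have := hk x h2 y hxy
          rwa [hb x h2 y hyp hxy] at this

/-- What has to be learned about the neighbour `g` of `h`. -/
def NeighborGoal [Fintype K] (H : SimpleGraph K) (χ : V → K) (φ : K → V) (σ : K → ℕ) (h g : K)
    (s : Knowledge V) : Prop :=
  (σ h < σ g → Found H χ (compIn H {y | σ h < σ y} g) φ s) ∧
    (σ g < σ h → φ g ∈ s.1 ∧ s(φ h, φ g) ∈ s.2)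

lemma monotone_neighborGoal [Fintype K] {H : SimpleGraph K} {χ : V → K} {φ : K → V}
    {σ : K → ℕ} (h g : K) : Monotone (NeighborGoal H χ φ σ h g) :=
  fun _ _ hs hg => ⟨fun hlt => monotone_found _ _ _ _ hs (hg.1 hlt),
    fun hlt => ⟨hs.1 (hg.2 hlt).1, hs.2 (hg.2 hlt).2⟩⟩

variable [Fintype V] [Fintype K]

open Classical in
/-- The neighbours of `v` from which the part `C` with boundary `ψ` can be found. -/
noncomputable def taskSet (G : SimpleGraph V) (κ : ℕ) (H : SimpleGraph K) (χ : V → K) (v : V)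
    (C : Finset K) (ψ : K → V) : Finset V :=
  (nbrs G v).filter fun u =>
    CanReach G κ (Found H χ C ψ) (budget (Fintype.card K) C.card) ({u}, ∅)

open Classical in
/-- The vertices from which the part `C` can be found, whatever boundary is prescribed. -/
noncomputable def startSet (G : SimpleGraph V) (κ : ℕ) (H : SimpleGraph K) (χ : V → K)
    (C : Finset K) : Finset V :=
  Finset.univ.filter fun u =>
    ∀ ψ, CanReach G κ (Found H χ C ψ) (budget (Fintype.card K) C.card) ({u}, ∅)

/-- A copy `φ` of `H` in `G` all of whose edges survive the cleaning: `σ` ranks its vertices,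
`W` contains the weakly reachable vertices, and the task sets hit by its edges are dense. -/
structure IsRobustCopy (G : SimpleGraph V) (κ : ℕ) (H : SimpleGraph K) (χ : V → K)
    (W : V → Finset V) (φ : K → V) (σ : K → ℕ) : Prop where
  injective : Function.Injective σ
  color : ∀ x, χ (φ x) = x
  adj : ∀ x y, H.Adj x y → G.Adj (φ x) (φ y)
  reach : ∀ (h b : K) (p : H.Walk h b), (∀ y ∈ p.support, σ b ≤ σ y) → φ b ∈ W (φ h)
  down : ∀ h b, H.Adj h b → σ b < σ h → (nbrs G (φ h)).card ≤ κ
  rich : ∀ h g, H.Adj h g → ∀ (C : Finset K) (ψ : K → V), (∀ i, ψ i ∈ W (φ h)) →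
    φ g ∈ taskSet G κ H χ (φ h) C ψ →
    (nbrs G (φ h)).card ≤ κ * (taskSet G κ H χ (φ h) C ψ).card
  start : ∀ h b, H.Adj h b → σ b < σ h → ∀ C : Finset K, φ h ∈ startSet G κ H χ C →
    Fintype.card V ≤ κ * (startSet G κ H χ C).card

namespace IsRobustCopy

variable {G : SimpleGraph V} {κ : ℕ} {H : SimpleGraph K} {χ : V → K} {W : V → Finset V}
  {φ : K → V} {σ : K → ℕ}

/-- From the minimum of a part one can find the part: the form used in inductions. -/
def FindsAbove (G : SimpleGraph V) (κ : ℕ) (H : SimpleGraph K) (χ : V → K) (φ : K → V) (σ : K → ℕ)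
    (h : K) : Prop :=
  ∀ s : Knowledge V, φ h ∈ s.1 →
    CanReach G κ (Found H χ (compIn H {y | σ h ≤ σ y} h) φ)
      (Fintype.card K * (1 + budget (Fintype.card K) ((compIn H {y | σ h ≤ σ y} h).card - 1))) s

/-- Search above the known vertex. If this does not exhaust the component, some edge of `H` leaves
the explored part towards a lower vertex y of the component. The image of y is prescribed boundary,
so it is now known, and the search continues above y until the minimum is reached. -/
lemma canReach_of_known (U : Set K)
    (hU : ∀ x ∈ U, ∀ y, σ x ≤ σ y → y ∈ U) (g : K) (hg : g ∈ U)
    (hP : ∀ h ∈ compIn H U g, FindsAbove G κ H χ φ σ h) (s : Knowledge V) (hs : φ g ∈ s.1) :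
    CanReach G κ (Found H χ (compIn H U g) φ)
      (budget (Fintype.card K) (compIn H U g).card) s := by
  classical
  have hsub : ∀ h ∈ compIn H U g, compIn H {y | σ h ≤ σ y} h ⊆ compIn H U g := fun h hh =>
    compIn_subset_of_mem (fun y hy => hU h (mem_of_mem_compIn hh) y hy) hh
  -- The counter `t` bounds the number of vertices of the component ranked at most `h`; it drops
  -- with every descent.
  have key : ∀ t : ℕ, ∀ h ∈ compIn H U g,
      ((compIn H U g).filter fun x => σ x ≤ σ h).card ≤ t → ∀ s : Knowledge V, φ h ∈ s.1 →
      CanReach G κ (Found H χ (compIn H U g) φ)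
        (t * (Fintype.card K * (1 + budget (Fintype.card K) ((compIn H U g).card - 1)))) s := by
    intro t
    induction t with
    | zero =>
      intro h hh hcard
      have : h ∈ (compIn H U g).filter fun x => σ x ≤ σ h := by simp [hh]
      rw [Finset.card_eq_zero.1 (Nat.le_zero.1 hcard)] at this
      simp at this
    | succ t ih =>
      intro h hh hcard s hs
      have hle : Fintype.card K * (1 + budget (Fintype.card K)
          ((compIn H {y | σ h ≤ σ y} h).card - 1)) ≤
          Fintype.card K * (1 + budget (Fintype.card K) ((compIn H U g).card - 1)) := by
        have := Finset.card_le_card (hsub h hh)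
        have := monotone_budget (Fintype.card K) (Nat.sub_le_sub_right this 1)
        gcongr
      have h1 := (hP h hh s hs).mono_steps hle
      rw [Nat.succ_mul, Nat.add_comm]
      refine h1.bind fun s' hs' hF => ?_
      by_cases heq : compIn H {y | σ h ≤ σ y} h = compIn H U g
      · rw [heq] at hF
        exact .of_goal hF _
      · obtain ⟨b, hb, hbn⟩ : ∃ b ∈ compIn H U g, b ∉ compIn H {y | σ h ≤ σ y} h := by
          by_contra! hcon
          exact heq ((hsub h hh).antisymm hcon)
        rw [← compIn_eq_of_mem hh] at hb
        have hself : h ∈ compIn H {y | σ h ≤ σ y} h := self_mem_compIn (by simp)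
        obtain ⟨x, hx, y, hy, hyU, hxy⟩ := exists_exit_compIn hb
          (compIn H {y | σ h ≤ σ y} h : Set K) (by simpa using hself) (by simpa using hbn)
        rw [compIn_eq_of_mem hh] at hyU
        simp only [Finset.mem_coe] at hx hy
        have hlt : σ y < σ h := by
          by_contra! hcon
          exact hy (adj_mem_compIn hx hxy hcon)
        -- The part found may use new vertices inside, but it agrees with `φ` at the exit vertex
        -- `y`.
        obtain ⟨φ', -, hb', hk⟩ := hF
        have hknown : φ y ∈ s'.1 := by
          rw [← hb' x hx y hy hxy]; exact (hk x hx y hxy).2.1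
        refine ih y hyU ?_ s' hknown
        have : ((compIn H U g).filter fun x => σ x ≤ σ y) ⊂
            ((compIn H U g).filter fun x => σ x ≤ σ h) := by
          rw [Finset.ssubset_iff_of_subset]
          · exact ⟨h, by simp [hh], by simp [hlt]⟩
          · intro z hz
            simp only [Finset.mem_filter] at hz ⊢
            exact ⟨hz.1, by omega⟩
        have := Finset.card_lt_card this
        omega
  have hself := self_mem_compIn (H := H) hg
  rw [budget_eq _ (Finset.card_pos.2 ⟨g, hself⟩)]
  exact key _ g hself (Finset.card_filter_le _ _) s hs

/-- Since the search succeeds from `φ g`, this vertex lies in a task set at `φ h`. Robustness makes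
that task set dense, so a random neighbour is as good a start with probability at least 1/κ. -/
lemma canReach_up_neighbor (hr : IsRobustCopy G κ H χ W φ σ) {h g : K} (hg : H.Adj h g)
    (hlt : σ h < σ g) (hP : ∀ h' ∈ compIn H {y | σ h < σ y} g, FindsAbove G κ H χ φ σ h')
    (s : Knowledge V) (hs : φ h ∈ s.1) :
    CanReach G κ (Found H χ (compIn H {y | σ h < σ y} g) φ)
      (budget (Fintype.card K) (compIn H {y | σ h < σ y} g).card + 1) s := by
  classical
  have hQ := canReach_of_known (G := G) (κ := κ) (χ := χ) (φ := φ) {y | σ h < σ y}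
    (fun x hx y hxy => lt_of_lt_of_le hx hxy) g hlt hP ({φ g}, ∅) rfl
  have hreach : ∀ x ∈ compIn H {y | σ h < σ y} g, ∀ i ∉ compIn H {y | σ h < σ y} g,
      H.Adj x i → φ i ∈ W (φ h) := by
    intro x hx i hiD hxi
    obtain ⟨p, hp⟩ := mem_compIn.1 hx
    have hih : σ i ≤ σ h := by
      by_contra! hcon
      exact hiD (adj_mem_compIn hx hxi hcon)
    -- The walk through `g` and the component to its boundary vertex `i` has its minimum at `i`.
    refine hr.reach h i ((SimpleGraph.Walk.cons hg p).concat hxi) ?_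
    intro y hy
    rw [SimpleGraph.Walk.support_concat, SimpleGraph.Walk.support_cons,
      List.mem_append, List.mem_cons, List.mem_singleton] at hy
    rcases hy with (rfl | hy) | rfl
    · exact hih
    · exact hih.trans (le_of_lt (hp y hy))
    · exact le_rfl
  generalize compIn H {y | σ h < σ y} g = D at hQ hreach
  -- Off the boundary, `ψ` takes the harmless value `φ h`, which lies in `W (φ h)` by the trivial
  -- walk.
  obtain ⟨ψ, hψ, hψW⟩ : ∃ ψ : K → V, (∀ x ∈ D, ∀ y ∉ D, H.Adj x y → ψ y = φ y) ∧
      ∀ i, ψ i ∈ W (φ h) := by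
    refine ⟨fun y => if (∃ x ∈ D, H.Adj x y) ∧ y ∉ D then φ y else φ h, ?_, ?_⟩
    · exact fun x hx y hy hxy => if_pos ⟨⟨x, hx, hxy⟩, hy⟩
    · intro i
      by_cases hi : (∃ x ∈ D, H.Adj x i) ∧ i ∉ D
      · simp only [if_pos hi]
        obtain ⟨⟨x, hx, hxi⟩, hiD⟩ := hi
        exact hreach x hx i hiD hxi
      · simp only [if_neg hi]
        exact hr.reach h h .nil (by simp)
  have hmem : φ g ∈ taskSet G κ H χ (φ h) D ψ := by
    rw [taskSet, Finset.mem_filter, mem_nbrs]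
    exact ⟨hr.adj h g hg, hQ.mono_goal fun s' _ hF =>
      hF.congr fun x hx y hy hxy => (hψ x hx y hy hxy).symm⟩
  refine Or.inr (Or.inr ⟨φ h, hs, taskSet G κ H χ (φ h) D ψ, Finset.filter_subset _ _,
    ⟨φ g, hmem⟩, hr.rich h g hg D ψ hψW hmem, fun u hu => ?_⟩)
  have hu' := (Finset.mem_filter.1 hu).2
  refine (hu'.mono_state (monotone_found _ _ _ _) ?_).mono_goal fun s' _ hF => hF.congr hψ
  exact ⟨by simp, by simp⟩

/-- As `φ h` has degree at most `κ`, even a single prescribed neighbour is a dense set of guesses.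
-/
lemma canReach_down_neighbor (hr : IsRobustCopy G κ H χ W φ σ) {h g : K} (hg : H.Adj h g)
    (hlt : σ g < σ h) (s : Knowledge V) (hs : φ h ∈ s.1) :
    CanReach G κ (fun s => φ g ∈ s.1 ∧ s(φ h, φ g) ∈ s.2) 1 s := by
  refine Or.inr (Or.inr ⟨φ h, hs, {φ g}, ?_, by simp, ?_, ?_⟩)
  · simpa using hr.adj h g hg
  · simpa using hr.down h g hg hlt
  · intro u hu
    rw [Finset.mem_singleton] at hu
    subst hu
    exact ⟨Set.mem_insert _ _, Set.mem_insert _ _⟩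

/-- Induction on the size of the part with minimum `h`: without `h` it splits into strictly smaller
components. The neighbours of `h` are treated one by one, and `found_above` glues the results. -/
lemma findsAbove (hr : IsRobustCopy G κ H χ W φ σ) (h : K) : FindsAbove G κ H χ φ σ h := by
  classical
  suffices ∀ N : ℕ, ∀ h, (compIn H {y | σ h ≤ σ y} h).card ≤ N → FindsAbove G κ H χ φ σ h from
    this _ h le_rfl
  intro N
  induction N with
  | zero =>
    intro h hcard
    have hself : h ∈ compIn H {y | σ h ≤ σ y} h := self_mem_compIn (le_refl (σ h))
    rw [Finset.card_eq_zero.1 (Nat.le_zero.1 hcard)] at hself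
    simp at hself
  | succ N ih =>
    intro h hcard s hs
    have hself : h ∈ compIn H {y | σ h ≤ σ y} h := self_mem_compIn (le_refl (σ h))
    have hDcard : ∀ g, H.Adj h g → σ h < σ g → (compIn H {y | σ h < σ y} g).card + 1 ≤
        (compIn H {y | σ h ≤ σ y} h).card := by
      intro g hg hlt
      refine Finset.card_lt_card ((Finset.ssubset_iff_of_subset (compIn_lt_subset_compIn_le
        (adj_mem_compIn hself hg (le_of_lt hlt)))).2 ⟨h, hself, ?_⟩)
      exact fun hx => lt_irrefl (σ h) (lt_of_mem_compIn hx)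
    have hgoal : ∀ g ∈ nbrs H h, ∀ s', s ≤ s' → CanReach G κ (NeighborGoal H χ φ σ h g)
        (1 + budget (Fintype.card K) ((compIn H {y | σ h ≤ σ y} h).card - 1)) s' := by
      intro g hg s' hs'
      rw [mem_nbrs] at hg
      rcases lt_trichotomy (σ h) (σ g) with hlt | he | hlt
      · have hD := hDcard g hg hlt
        have hP : ∀ h' ∈ compIn H {y | σ h < σ y} g, FindsAbove G κ H χ φ σ h' := by
          intro h' hh'
          refine ih h' ?_
          have := Finset.card_le_card (compIn_le_subset_compIn_lt hh')
          omega
        have h1 := hr.canReach_up_neighbor hg hlt hP s' (hs'.1 hs)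
        have h2 : CanReach G κ (NeighborGoal H χ φ σ h g) _ s' :=
          h1.mono_goal fun s'' _ hF => ⟨fun _ => hF, fun hlt' => absurd hlt' (lt_asymm hlt)⟩
        refine h2.mono_steps ?_
        have := monotone_budget (Fintype.card K) (Nat.le_sub_one_of_lt hD)
        omega
      · exact absurd (hr.injective he) hg.ne
      · have h1 := hr.canReach_down_neighbor hg hlt s' (hs'.1 hs)
        have h2 : CanReach G κ (NeighborGoal H χ φ σ h g) _ s' :=
          h1.mono_goal fun s'' _ hF => ⟨fun hlt' => absurd hlt' (lt_asymm hlt), fun _ => hF⟩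
        exact h2.mono_steps (by omega)
    have hall := CanReach.forall_finset (nbrs H h) (fun g _ => monotone_neighborGoal h g) hgoal
    refine CanReach.mono_steps ?_ (Nat.mul_le_mul_right _ (Finset.card_le_univ (nbrs H h)))
    refine hall.mono_goal fun s' hs' hg => ?_
    exact found_above hr.injective (hr.color h) (hs'.1 hs)
      (fun g hadj hlt => (hg g (mem_nbrs.2 hadj)).1 hlt)
      (fun g hadj hlt => (hg g (mem_nbrs.2 hadj)).2 hlt)

/-- A robust copy of `H` makes it possible to find a coloured copy of `H` up to isolated vertices,
starting without any knowledge. -/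
theorem canReach_copy (hr : IsRobustCopy G κ H χ W φ σ) :
    CanReach G κ (fun s => ∃ f : K → V, ∀ x y, H.Adj x y →
        χ (f x) = x ∧ s(f x, f y) ∈ s.2)
      (Fintype.card K * (budget (Fintype.card K) (Fintype.card K) + 1)) (∅, ∅) := by
  classical
  have hreach : ∀ x, (∃ y, H.Adj x y) → ∀ s : Knowledge V,
      CanReach G κ (Found H χ (compIn H Set.univ x) φ)
        (budget (Fintype.card K) (Fintype.card K) + 1) s := by
    rintro x ⟨y, hxy⟩ s
    have hx : x ∈ compIn H Set.univ x := self_mem_compIn (Set.mem_univ x)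
    -- A vertex of maximum rank has only lower neighbours, so the field `start` applies to it.
    obtain ⟨g, hg, hmax⟩ := Finset.exists_max_image (compIn H Set.univ x) σ ⟨x, hx⟩
    obtain ⟨b, hgb⟩ : ∃ b, H.Adj g b := by
      by_cases hgx : g = x
      · exact ⟨y, hgx ▸ hxy⟩
      · obtain ⟨p, -⟩ := mem_compIn.1 (mem_compIn_symm hg)
        cases p with
        | nil => exact absurd rfl hgx
        | cons h _ => exact ⟨_, h⟩
    have hb : b ∈ compIn H Set.univ x := adj_mem_compIn hg hgb (Set.mem_univ b)
    have hlt : σ b < σ g := lt_of_le_of_ne (hmax b hb) fun he => hgb.ne (hr.injective he).symm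
    -- A full component of `H` has no boundary, so every prescription is met vacuously.
    have hempty : ∀ ψ : K → V, ∀ a ∈ compIn H Set.univ x, ∀ c ∉ compIn H Set.univ x, H.Adj a c →
        φ c = ψ c := fun ψ a ha c hc hac => absurd (adj_mem_compIn ha hac (Set.mem_univ c)) hc
    have hmem : φ g ∈ startSet G κ H χ (compIn H Set.univ x) := by
      rw [startSet, Finset.mem_filter]
      refine ⟨Finset.mem_univ _, fun ψ => ?_⟩
      have := canReach_of_known (G := G) (κ := κ) (H := H) (χ := χ) (φ := φ) (σ := σ) Set.univ
        (fun _ _ _ _ => Set.mem_univ _) g (Set.mem_univ g) (fun h _ => hr.findsAbove h)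
        ({φ g}, ∅) rfl
      rw [compIn_eq_of_mem hg] at this
      exact this.mono_goal fun s' _ hF => hF.congr (hempty ψ)
    refine Or.inr (Or.inl ⟨_, hr.start g b hgb hlt _ hmem, fun u hu => ?_⟩)
    refine (((Finset.mem_filter.1 hu).2 φ).mono_steps
      (monotone_budget _ (Finset.card_le_univ _))).mono_state (monotone_found _ _ _ _) ?_
    exact ⟨by simp, by simp⟩
  have hall := CanReach.forall_finset (G := G) (κ := κ) (s := (∅, ∅))
    (goals := fun x => Found H χ (compIn H Set.univ x) φ)
    ((Finset.univ : Finset K).filter fun x => ∃ y, H.Adj x y)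
    (fun x _ => monotone_found _ _ _ _)
    (fun x hx s' _ => hreach x (by simpa using hx) s')
  refine CanReach.mono_steps (hall.mono_goal fun s' _ hg => ?_)
    (Nat.mul_le_mul_right _ (Finset.card_le_univ _))
  have hparts : ∀ D : Finset K, ∃ f : K → V, Found H χ D φ s' → (∀ x ∈ D, χ (f x) = x) ∧
      ∀ x ∈ D, ∀ y, H.Adj x y → s(f x, f y) ∈ s'.2 := by
    intro D
    by_cases hD : Found H χ D φ s'
    · obtain ⟨f, h1, -, h3⟩ := hD
      exact ⟨f, fun _ => ⟨h1, fun x hx y hxy => (h3 x hx y hxy).2.2⟩⟩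
    · exact ⟨φ, fun h => absurd h hD⟩
  choose F hF using hparts
  refine ⟨fun x => F (compIn H Set.univ x) x, fun x y hxy => ?_⟩
  have hx : x ∈ compIn H Set.univ x := self_mem_compIn (Set.mem_univ x)
  have hy : y ∈ compIn H Set.univ x := adj_mem_compIn hx hxy (Set.mem_univ y)
  obtain ⟨h1, h2⟩ := hF _ (hg x (by simpa using ⟨y, hxy⟩))
  simp only [compIn_eq_of_mem hy]
  exact ⟨h1 x hx, h2 x hx y hxy⟩

end IsRobustCopy

end PartialCopies

/-! ### Edge-disjoint copies, colour coding and cleaning -/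

section Cleaning

variable {V K : Type*}

open Classical in
/-- The edges at `v` leading to a member of the sparse set `S`. -/
noncomputable def sparseEdges (κ N : ℕ) (S : Finset V) (R : V → Finset V) : Finset (Sym2 V) :=
  if κ * S.card < N then S.biUnion fun u => (R u).image fun w => s(u, w) else ∅

/-- Edges are collected only if κ|S| < N, and each member of `S` contributes at most `M` of them. -/
lemma card_sparseEdges_le (κ N M : ℕ) (S : Finset V) (R : V → Finset V)
    (hR : ∀ u, (R u).card ≤ M) : κ * (sparseEdges κ N S R).card ≤ M * N := by
  classical
  unfold sparseEdges
  split_ifs with h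
  · calc _ ≤ κ * (S.card * M) := Nat.mul_le_mul_left κ
          (Finset.card_biUnion_le_card_mul _ _ _ fun u _ => Finset.card_image_le.trans (hR u))
      _ = M * (κ * S.card) := by ring
      _ ≤ M * N := Nat.mul_le_mul_left M h.le
  · simp

/-- This is how an edge surviving the cleaning certifies that a set of guesses is dense. -/
lemma mem_sparseEdges {κ N : ℕ} {S : Finset V} {R : V → Finset V} {u w : V} (hu : u ∈ S)
    (hw : w ∈ R u) (h : s(u, w) ∉ sparseEdges κ N S R) : N ≤ κ * S.card := by
  classical
  by_contra! hlt
  refine h ?_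
  rw [sparseEdges, if_pos hlt, Finset.mem_biUnion]
  exact ⟨u, hu, Finset.mem_image_of_mem _ hw⟩

variable [Fintype V] [Fintype K]

/-- A graph far from `H`-free contains many edge-disjoint copies of `H`. -/
lemma exists_edge_disjoint_copies [Nonempty V] (H : SimpleGraph K) (G : SimpleGraph V) (d : ℕ)
    (hfar : ∀ G' : SimpleGraph V, H.Free G' →
      Fintype.card V ≤ d * (symmDiff G.edgeSet G'.edgeSet).ncard) (m : ℕ)
    (hm : ∀ i < m, d * (Fintype.card K ^ 2 * i) < Fintype.card V) :
    ∃ φ : ℕ → K → V, (∀ i < m, Function.Injective (φ i) ∧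
        ∀ x y, H.Adj x y → G.Adj (φ i x) (φ i y)) ∧
      ∀ i < m, ∀ j < m, ∀ x y x' y', H.Adj x y → H.Adj x' y' →
        s(φ i x, φ i y) = s(φ j x', φ j y') → i = j := by
  classical
  induction m with
  | zero =>
    exact ⟨fun _ _ => Classical.arbitrary V, by simp, by simp⟩
  | succ m ih =>
    obtain ⟨φ, hφ, hdisj⟩ := ih fun i hi => hm i (by omega)
    -- Deleting all pairs spanned by the earlier copies, at most k² per copy, is too little to make
    -- `G` free of `H`; a copy that survives is edge-disjoint from them.
    let U : Finset (Sym2 V) := (Finset.range m).biUnion fun i =>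
      (Finset.univ : Finset (K × K)).image fun z => s(φ i z.1, φ i z.2)
    have hU : U.card ≤ Fintype.card K ^ 2 * m := by
      calc U.card ≤ (Finset.range m).card * Fintype.card K ^ 2 := by
            refine Finset.card_biUnion_le_card_mul _ _ _ fun i _ => ?_
            refine Finset.card_image_le.trans ?_
            simp [sq]
        _ = _ := by simp [mul_comm]
    have hcontains : ¬ H.Free (G.deleteEdges (U : Set (Sym2 V))) := by
      intro hfree
      have h1 := hfar _ hfree
      have hsub : symmDiff G.edgeSet (G.deleteEdges (U : Set (Sym2 V))).edgeSet ⊆ (U : Set _) := by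
        rw [SimpleGraph.edgeSet_deleteEdges]
        intro e he
        rw [Set.mem_symmDiff, Set.mem_sdiff] at he
        tauto
      have h2 := Set.ncard_le_ncard hsub (Finset.finite_toSet U)
      rw [Set.ncard_coe_finset] at h2
      have h3 := hm m (by omega)
      have h4 : d * (symmDiff G.edgeSet (G.deleteEdges (U : Set (Sym2 V))).edgeSet).ncard ≤
        d * (Fintype.card K ^ 2 * m) := Nat.mul_le_mul_left d (h2.trans hU)
      omega
    obtain ⟨f⟩ : H.IsContained (G.deleteEdges (U : Set (Sym2 V))) := not_not.1 hcontains
    have hf : ∀ x y, H.Adj x y → G.Adj (f x) (f y) ∧ s(f x, f y) ∉ U := by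
      intro x y hxy
      have := f.toHom.map_adj hxy
      rw [SimpleGraph.deleteEdges_adj] at this
      exact ⟨this.1, fun h => this.2 (by simpa using h)⟩
    have hnew : ∀ i < m, ∀ x y x' y', H.Adj x' y' → s(φ i x, φ i y) ≠ s(f x', f y') := by
      intro i hi x y x' y' h' he
      refine (hf x' y' h').2 ?_
      rw [← he]
      simp only [U, Finset.mem_biUnion, Finset.mem_image]
      exact ⟨i, Finset.mem_range.2 hi, (x, y), Finset.mem_univ _, rfl⟩
    refine ⟨fun i => if i < m then φ i else f, ?_, ?_⟩
    · intro i hi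
      by_cases him : i < m
      · simpa [him] using hφ i him
      · simp only [him, if_false]
        exact ⟨f.injective, fun x y h => (hf x y h).1⟩
    · intro i hi j hj x y x' y' h h' he
      by_cases him : i < m <;> by_cases hjm : j < m
      · simp only [him, hjm, if_true] at he
        exact hdisj i him j hjm x y x' y' h h' he
      · simp only [him, hjm, if_true, if_false] at he
        exact absurd he (hnew i him x y x' y' h')
      · simp only [him, hjm, if_true, if_false] at he
        exact absurd he.symm (hnew j hjm x' y' x y h)
      · omega

/-- Colour coding: some colouring makes a constant fraction of given copies colourful. -/
lemma exists_coloring [Nonempty K] (m : ℕ) (φ : ℕ → K → V)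
    (hφ : ∀ i < m, Function.Injective (φ i)) :
    ∃ (χ : V → K) (I : Finset ℕ), (∀ i ∈ I, i < m ∧ ∀ x, χ (φ i x) = x) ∧
      m ≤ Fintype.card K ^ Fintype.card K * I.card := by
  classical
  let I : (V → K) → Finset ℕ := fun χ => (Finset.range m).filter fun i => ∀ x, χ (φ i x) = x
  suffices h : ∃ χ ∈ (Finset.univ : Finset (V → K)),
      m ≤ Fintype.card K ^ Fintype.card K * (I χ).card by
    obtain ⟨χ, -, hχ⟩ := h
    exact ⟨χ, I χ, fun i hi => by simpa [I] using hi, hχ⟩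
  -- Averaging over all colourings: each copy is colourful for at least a k⁻ᵏ fraction of them.
  refine Finset.exists_le_of_sum_le Finset.univ_nonempty ?_
  rw [Finset.sum_const, smul_eq_mul, ← Finset.mul_sum]
  have hswap : ∑ χ : V → K, (I χ).card =
      ∑ i ∈ Finset.range m, (Finset.univ.filter fun χ : V → K => ∀ x, χ (φ i x) = x).card :=
    Finset.sum_card_bipartiteAbove_eq_sum_card_bipartiteBelow (s := Finset.univ)
      (t := Finset.range m) fun (χ : V → K) i => ∀ x, χ (φ i x) = x
  rw [hswap, Finset.mul_sum]
  have hone : ∀ i ∈ Finset.range m, (Finset.univ : Finset (V → K)).card ≤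
      Fintype.card K ^ Fintype.card K *
        (Finset.univ.filter fun χ : V → K => ∀ x, χ (φ i x) = x).card := by
    intro i hi
    have hinj := hφ i (Finset.mem_range.1 hi)
    have hcard : Fintype.card K ^ Fintype.card K = (Finset.univ : Finset (K → K)).card := by
      rw [Finset.card_univ, Fintype.card_fun]
    rw [hcard, ← Finset.card_product]
    -- Recolouring copy `i` properly while recording its old colours is injective, which yields the
    -- k⁻ᵏ fraction.
    let override : (V → K) → V → K := fun χ v => if h : ∃ x, φ i x = v then h.choose else χ v
    have hoverride : ∀ χ x, override χ (φ i x) = x := by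
      intro χ x
      have h : ∃ y, φ i y = φ i x := ⟨x, rfl⟩
      simp only [override, dif_pos h]
      exact hinj h.choose_spec
    refine Finset.card_le_card_of_injOn (fun χ => (χ ∘ φ i, override χ)) ?_ ?_
    · intro χ _
      exact Finset.mem_coe.2 (Finset.mem_product.2
        ⟨Finset.mem_univ _, Finset.mem_filter.2 ⟨Finset.mem_univ _, hoverride χ⟩⟩)
    · intro χ _ χ' _ he
      rw [Prod.mk.injEq] at he
      funext v
      by_cases h : ∃ x, φ i x = v
      · obtain ⟨x, rfl⟩ := h
        exact congrFun he.1 x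
      · have := congrFun he.2 v
        simpa only [override, dif_neg h] using this
  calc _ = ∑ _i ∈ Finset.range m, (Finset.univ : Finset (V → K)).card := by simp [mul_comm]
    _ ≤ _ := Finset.sum_le_sum hone

/-- The degree sum is bounded by the sizes of weak reachability sets. -/
lemma sum_card_nbrs_le (G : SimpleGraph V) (W : V → Finset V) (M : ℕ) (hM : ∀ v, (W v).card ≤ M)
    (hW : ∀ u v, G.Adj u v → u ∈ W v ∨ v ∈ W u) :
    ∑ v, (nbrs G v).card ≤ 2 * M * Fintype.card V := by
  classical
  -- Each edge is charged to an endpoint whose set `W` contains the other endpoint.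
  have h1 : ∀ v, (nbrs G v).card ≤ (W v).card + (Finset.univ.filter fun u => v ∈ W u).card := by
    intro v
    refine (Finset.card_le_card ?_).trans (Finset.card_union_le _ _)
    intro u hu
    rw [mem_nbrs] at hu
    simpa using (hW v u hu).symm
  have h2 : ∑ v, (Finset.univ.filter fun u => v ∈ W u).card = ∑ u, (W u).card := by
    have := Finset.sum_card_bipartiteAbove_eq_sum_card_bipartiteBelow (s := Finset.univ)
      (t := Finset.univ) fun v u => v ∈ W u
    simpa [Finset.bipartiteAbove, Finset.bipartiteBelow] using this
  have h3 : ∑ u, (W u).card ≤ Fintype.card V * M := by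
    calc _ ≤ ∑ _u : V, M := Finset.sum_le_sum fun u _ => hM u
      _ = _ := by simp
  calc _ ≤ ∑ v, ((W v).card + (Finset.univ.filter fun u => v ∈ W u).card) :=
        Finset.sum_le_sum fun v _ => h1 v
    _ ≤ 2 * M * Fintype.card V := by
      rw [Finset.sum_add_distrib, h2]
      nlinarith

/-- The constant in the bound on the number of edges removed by the cleaning. -/
def cleaningConst (k M : ℕ) : ℕ := (2 ^ k * M ^ k + M) * (2 * M) + 2 ^ k * M

/-- Cleaning: after the removal of few edges every colourful copy of `H` is robust. -/
lemma exists_cleaning (H : SimpleGraph K) (G : SimpleGraph V) (χ : V → K) (κ M : ℕ) (ρ : V → ℕ)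
    (W : V → Finset V) (hρ : Function.Injective ρ) (hM : ∀ v, (W v).card ≤ M)
    (hW : ∀ (v x : V) (P : G.Walk v x), P.IsPath → P.length ≤ Fintype.card K + 1 →
      (∀ y ∈ P.support, ρ x ≤ ρ y) → x ∈ W v) :
    ∃ X : Finset (Sym2 V), κ * X.card ≤ cleaningConst (Fintype.card K) M * Fintype.card V ∧
      ∀ φ : K → V, (∀ x, χ (φ x) = x) →
        (∀ x y, H.Adj x y → G.Adj (φ x) (φ y) ∧ s(φ x, φ y) ∉ X) →
        IsRobustCopy G κ H χ W φ (ρ ∘ φ) := by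
  classical
  have hadj : ∀ u v, G.Adj u v → ρ v ≤ ρ u → v ∈ W u := by
    intro u v huv hle
    refine hW u v (.cons huv .nil) (by simp [huv.ne]) (by simp) ?_
    intro y hy
    simp only [SimpleGraph.Walk.support_cons, SimpleGraph.Walk.support_nil, List.mem_cons,
      List.not_mem_nil, or_false] at hy
    rcases hy with rfl | rfl
    exacts [hle, le_rfl]
  have hdeg : ∑ v, (nbrs G v).card ≤ 2 * M * Fintype.card V := by
    refine sum_card_nbrs_le G W M hM fun u v huv => ?_
    rcases le_total (ρ u) (ρ v) with h | h
    · exact Or.inl (hadj v u huv.symm h)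
    · exact Or.inr (hadj u v huv h)
  -- `X1` cuts vertices off from their sparse task sets, over all parts and all boundaries in `W v`.
  -- `X2` cuts vertices of degree above `κ` off from `W v`. `X3` cuts members of sparse start sets
  -- off from their sets `W`.
  let X1 : Finset (Sym2 V) := Finset.univ.biUnion fun v =>
    ((Finset.univ : Finset (Finset K)) ×ˢ Fintype.piFinset fun _ : K => W v).biUnion fun t =>
      sparseEdges κ (nbrs G v).card (taskSet G κ H χ v t.1 t.2) fun _ => {v}
  let X2 : Finset (Sym2 V) := Finset.univ.biUnion fun v =>
    (W v).biUnion fun b => sparseEdges κ (nbrs G v).card {b} fun _ => {v}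
  let X3 : Finset (Sym2 V) := (Finset.univ : Finset (Finset K)).biUnion fun C =>
    sparseEdges κ (Fintype.card V) (startSet G κ H χ C) W
  have h1 : κ * X1.card ≤ 2 ^ Fintype.card K * M ^ Fintype.card K * (2 * M * Fintype.card V) := by
    calc κ * X1.card ≤ κ * ∑ v, ∑ t ∈ (Finset.univ : Finset (Finset K)) ×ˢ
          Fintype.piFinset fun _ : K => W v,
            (sparseEdges κ (nbrs G v).card (taskSet G κ H χ v t.1 t.2) fun _ => {v}).card :=
        Nat.mul_le_mul_left κ (Finset.card_biUnion_le.trans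
          (Finset.sum_le_sum fun v _ => Finset.card_biUnion_le))
      _ = ∑ v, ∑ t ∈ (Finset.univ : Finset (Finset K)) ×ˢ Fintype.piFinset fun _ : K => W v,
            κ * (sparseEdges κ (nbrs G v).card (taskSet G κ H χ v t.1 t.2) fun _ => {v}).card := by
        simp only [Finset.mul_sum]
      _ ≤ ∑ v, 2 ^ Fintype.card K * M ^ Fintype.card K * (nbrs G v).card := by
        refine Finset.sum_le_sum fun v _ => ?_
        refine (Finset.sum_le_card_nsmul _ _ (nbrs G v).card fun t _ => ?_).trans ?_
        · simpa using card_sparseEdges_le κ (nbrs G v).card 1 (taskSet G κ H χ v t.1 t.2)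
            (fun _ => {v}) (fun _ => by simp)
        · rw [smul_eq_mul, Finset.card_product, Fintype.card_piFinset, Finset.prod_const,
            Finset.card_univ, Finset.card_univ, Fintype.card_finset]
          exact Nat.mul_le_mul_right _ (Nat.mul_le_mul_left _ (Nat.pow_le_pow_left (hM v) _))
      _ = 2 ^ Fintype.card K * M ^ Fintype.card K * ∑ v, (nbrs G v).card := by
        rw [Finset.mul_sum]
      _ ≤ _ := Nat.mul_le_mul_left _ hdeg
  have h2 : κ * X2.card ≤ M * (2 * M * Fintype.card V) := by
    calc κ * X2.card ≤ κ * ∑ v, ∑ b ∈ W v,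
            (sparseEdges κ (nbrs G v).card {b} fun _ => {v}).card :=
        Nat.mul_le_mul_left κ (Finset.card_biUnion_le.trans
          (Finset.sum_le_sum fun v _ => Finset.card_biUnion_le))
      _ = ∑ v, ∑ b ∈ W v, κ * (sparseEdges κ (nbrs G v).card {b} fun _ => {v}).card := by
        simp only [Finset.mul_sum]
      _ ≤ ∑ v, M * (nbrs G v).card := by
        refine Finset.sum_le_sum fun v _ => ?_
        refine (Finset.sum_le_card_nsmul _ _ (nbrs G v).card fun b _ => ?_).trans ?_
        · simpa using card_sparseEdges_le κ (nbrs G v).card 1 {b}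
            (fun _ => {v}) (fun _ => by simp)
        · rw [smul_eq_mul]
          exact Nat.mul_le_mul_right _ (hM v)
      _ = M * ∑ v, (nbrs G v).card := by rw [Finset.mul_sum]
      _ ≤ _ := Nat.mul_le_mul_left _ hdeg
  have h3 : κ * X3.card ≤ 2 ^ Fintype.card K * (M * Fintype.card V) := by
    calc κ * X3.card ≤ κ * ∑ C : Finset K,
            (sparseEdges κ (Fintype.card V) (startSet G κ H χ C) W).card :=
        Nat.mul_le_mul_left κ Finset.card_biUnion_le
      _ = ∑ C : Finset K, κ * (sparseEdges κ (Fintype.card V) (startSet G κ H χ C) W).card := by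
        rw [Finset.mul_sum]
      _ ≤ ∑ _C : Finset K, M * Fintype.card V :=
        Finset.sum_le_sum fun C _ => card_sparseEdges_le _ _ _ _ _ hM
      _ = _ := by simp
  refine ⟨X1 ∪ (X2 ∪ X3), ?_, ?_⟩
  · calc _ ≤ κ * (X1.card + (X2.card + X3.card)) := Nat.mul_le_mul_left κ
          ((Finset.card_union_le _ _).trans (Nat.add_le_add_left (Finset.card_union_le _ _) _))
      _ = κ * X1.card + (κ * X2.card + κ * X3.card) := by ring
      _ ≤ _ := Nat.add_le_add h1 (Nat.add_le_add h2 h3)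
      _ = _ := by rw [cleaningConst]; ring
  · intro φ hcol hφ
    have hinj : Function.Injective φ := fun x y h => by rw [← hcol x, ← hcol y, h]
    have hX1 : ∀ x y, H.Adj x y → s(φ x, φ y) ∉ X1 := fun x y h hm =>
      (hφ x y h).2 (Finset.mem_union_left _ hm)
    have hX2 : ∀ x y, H.Adj x y → s(φ x, φ y) ∉ X2 := fun x y h hm =>
      (hφ x y h).2 (Finset.mem_union_right _ (Finset.mem_union_left _ hm))
    have hX3 : ∀ x y, H.Adj x y → s(φ x, φ y) ∉ X3 := fun x y h hm =>
      (hφ x y h).2 (Finset.mem_union_right _ (Finset.mem_union_right _ hm))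
    refine ⟨hρ.comp hinj, hcol, fun x y h => (hφ x y h).1, ?_, ?_, ?_, ?_⟩
    · intro h b p hp
      let f : H →g G := ⟨φ, fun {x y} hxy => (hφ x y hxy).1⟩
      -- Shortening the walk to a path bounds its length by the number of vertices of `H` and visits
      -- no new vertices.
      refine hW (φ h) (φ b) (p.bypass.map f) (SimpleGraph.Walk.IsPath.map hinj p.bypass_isPath) ?_ ?_
      · rw [SimpleGraph.Walk.length_map]
        exact (p.bypass_isPath.length_lt).le.trans (Nat.le_succ _)
      · intro y hy
        rw [SimpleGraph.Walk.support_map, List.mem_map] at hy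
        obtain ⟨z, hz, rfl⟩ := hy
        exact hp z (p.support_bypass_subset_support hz)
    · intro h b hhb hlt
      have hadj' := (hφ h b hhb).1
      have hb : φ b ∈ W (φ h) := hadj _ _ hadj' hlt.le
      have hn : s(φ b, φ h) ∉ sparseEdges κ (nbrs G (φ h)).card {φ b} fun _ => {φ h} := by
        intro hm
        refine hX2 h b hhb ?_
        rw [Sym2.eq_swap]
        exact Finset.mem_biUnion.2 ⟨φ h, Finset.mem_univ _, Finset.mem_biUnion.2 ⟨φ b, hb, hm⟩⟩
      simpa using mem_sparseEdges (R := fun _ => {φ h}) (Finset.mem_singleton_self (φ b))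
        (Finset.mem_singleton_self (φ h)) hn
    · intro h g hhg C ψ hψ hg
      refine mem_sparseEdges (R := fun _ => {φ h}) hg (Finset.mem_singleton_self _) ?_
      intro hm
      refine hX1 h g hhg ?_
      rw [Sym2.eq_swap]
      exact Finset.mem_biUnion.2 ⟨φ h, Finset.mem_univ _, Finset.mem_biUnion.2 ⟨(C, ψ),
        Finset.mem_product.2 ⟨Finset.mem_univ _, Fintype.mem_piFinset.2 hψ⟩, hm⟩⟩
    · intro h b hhb hlt C hC
      refine mem_sparseEdges hC (hadj _ _ (hφ h b hhb).1 hlt.le) ?_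
      exact fun hm => hX3 h b hhb (Finset.mem_biUnion.2 ⟨C, Finset.mem_univ _, hm⟩)

/-- The inverse density with which an exploration finds a copy of a `k`-vertex graph. -/
def densityConst (k M d : ℕ) : ℕ := cleaningConst k M * ((k ^ 2 + 1) * k ^ k) * d + 1

/-- In a graph of bounded admissibility that is far from `H`-free, a copy of `H` can be explored
with a bounded number of lucky guesses. -/
theorem canReach_copy_of_far [Nonempty V] (H : SimpleGraph K) (G : SimpleGraph V) (p d : ℕ)
    (hd : 0 < d) (hadm : adm G (Fintype.card K + 1) ≤ (p : ℕ∞))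
    (hfar : ∀ G' : SimpleGraph V, H.Free G' →
      Fintype.card V ≤ d * (symmDiff G.edgeSet G'.edgeSet).ncard) :
    CanReach G (densityConst (Fintype.card K)
        ((p * (Fintype.card K + 1) + 1) ^ (Fintype.card K + 1)) d)
      (fun s => ∃ f : K → V, (∀ x y x' y', H.Adj x y → H.Adj x' y' → f x = f x' → x = x') ∧
        ∀ x y, H.Adj x y → s(f x, f y) ∈ s.2)
      (Fintype.card K * (budget (Fintype.card K) (Fintype.card K) + 1)) (∅, ∅) := by
  classical
  rcases isEmpty_or_nonempty K with hK | hK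
  · exact .of_goal ⟨isEmptyElim, isEmptyElim, isEmptyElim⟩ _
  obtain ⟨ρ, W, hρ, hM, hW⟩ := exists_weakReach_of_adm_le G (Fintype.card K + 1) p hadm
  generalize (p * (Fintype.card K + 1) + 1) ^ (Fintype.card K + 1) = M at hM ⊢
  have hVpos : 0 < Fintype.card V := Fintype.card_pos
  have hex : ∃ m, Fintype.card V ≤ d * ((Fintype.card K ^ 2 + 1) * m) :=
    ⟨Fintype.card V, by nlinarith [Nat.zero_le (Fintype.card K ^ 2 * Fintype.card V)]⟩
  have hm := Nat.find_spec hex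
  have hmin := fun i (hi : i < Nat.find hex) => Nat.find_min hex hi
  generalize Nat.find hex = m at hm hmin
  obtain ⟨φ, hφ, hdisj⟩ := exists_edge_disjoint_copies H G d hfar m fun i hi => by
    refine lt_of_le_of_lt (Nat.mul_le_mul_left d (Nat.mul_le_mul_right i ?_)) (not_le.1 (hmin i hi))
    omega
  obtain ⟨χ, I, hI, hIcard⟩ := exists_coloring m φ fun i hi => (hφ i hi).1
  obtain ⟨X, hX, hrob⟩ := exists_cleaning H G χ
    (densityConst (Fintype.card K) M d) M ρ W hρ hM hW
  obtain ⟨i, hi, hiX⟩ : ∃ i ∈ I, ∀ x y, H.Adj x y → s(φ i x, φ i y) ∉ X := by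
    by_contra! hcon
    choose! x y hxy hmem using hcon
    -- If every colourful copy loses an edge, edge-disjointness makes the lost edges distinct.
    have hle : I.card ≤ X.card := by
      refine Finset.card_le_card_of_injOn (fun i => s(φ i (x i), φ i (y i))) hmem ?_
      intro i hi j hj he
      exact hdisj i (hI i hi).1 j (hI j hj).1 _ _ _ _ (hxy i hi) (hxy j hj) he
    have h1 : cleaningConst (Fintype.card K) M * Fintype.card V ≤
        cleaningConst (Fintype.card K) M *
          ((Fintype.card K ^ 2 + 1) * Fintype.card K ^ Fintype.card K) * d * X.card := by
      calc _ ≤ cleaningConst (Fintype.card K) M * (d * ((Fintype.card K ^ 2 + 1) *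
            (Fintype.card K ^ Fintype.card K * X.card))) := by
            refine Nat.mul_le_mul_left _ (hm.trans ?_)
            gcongr
            exact hIcard.trans (Nat.mul_le_mul_left _ hle)
        _ = _ := by ring
    have h2 := hX.trans h1
    -- The summand 1 in `densityConst` makes κ|X| exceed the right side unless `X` is empty, which
    -- would leave no copies at all.
    rw [densityConst, Nat.add_mul, one_mul] at h2
    have hX0 : X.card = 0 := by omega
    have hm0 : m = 0 := by
      have : I.card = 0 := by omega
      rw [this] at hIcard
      omega
    rw [hm0] at hm
    omega
  have hr := hrob (φ i) (hI i hi).2 fun x y hxy =>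
    ⟨(hφ i (hI i hi).1).2 x y hxy, hiX x y hxy⟩
  exact hr.canReach_copy.mono_goal fun s _ ⟨f, hf⟩ => ⟨f, fun x y x' y' h h' he => by
    rw [← (hf x y h).1, ← (hf x' y' h').1, he], fun x y h => (hf x y h).2⟩

end Cleaning

/-! ### Expectations over finite distributions -/

section Expectation

open scoped ENNReal

variable {α β : Type*}

/-- The expectation of `f` under `p`. -/
noncomputable def expect (p : PMF α) (f : α → ℝ≥0∞) : ℝ≥0∞ := ∑' a, p a * f a

@[simp] lemma expect_pure (a : α) (f : α → ℝ≥0∞) : expect (PMF.pure a) f = f a := by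
  classical
  rw [expect, tsum_eq_single a]
  · simp
  · intro b hb
    simp [hb]

lemma expect_bind (p : PMF α) (g : α → PMF β) (f : β → ℝ≥0∞) :
    expect (p.bind g) f = expect p fun a => expect (g a) f := by
  simp only [expect, PMF.bind_apply, ← ENNReal.tsum_mul_right, ← ENNReal.tsum_mul_left]
  rw [ENNReal.tsum_comm]
  simp only [mul_assoc]

lemma expect_map (p : PMF α) (g : α → β) (f : β → ℝ≥0∞) :
    expect (p.map g) f = expect p (f ∘ g) := by
  rw [← PMF.bind_pure_comp, expect_bind]
  simp only [Function.comp_apply, expect_pure]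
  rfl

lemma expect_mono {p : PMF α} {f g : α → ℝ≥0∞} (h : ∀ a ∈ p.support, f a ≤ g a) :
    expect p f ≤ expect p g := by
  refine ENNReal.tsum_le_tsum fun a => ?_
  by_cases ha : p a = 0
  · simp [ha]
  · exact mul_le_mul_right (h a ((PMF.mem_support_iff p a).2 ha)) _

lemma expect_const (p : PMF α) (c : ℝ≥0∞) : expect p (fun _ => c) = c := by
  rw [expect, ENNReal.tsum_mul_right, PMF.tsum_coe, one_mul]

lemma le_expect {p : PMF α} {f : α → ℝ≥0∞} {c : ℝ≥0∞} (h : ∀ a ∈ p.support, c ≤ f a) :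
    c ≤ expect p f := by
  rw [← expect_const p c]
  exact expect_mono h

lemma expect_add (p : PMF α) (f g : α → ℝ≥0∞) :
    expect p (fun a => f a + g a) = expect p f + expect p g := by
  simp only [expect, mul_add, ENNReal.tsum_add]

lemma expect_mul_right (p : PMF α) (f : α → ℝ≥0∞) (c : ℝ≥0∞) :
    expect p (fun a => f a * c) = expect p f * c := by
  simp only [expect, ← mul_assoc, ENNReal.tsum_mul_right]

open Classical in
/-- The probability of the event `q`. -/
noncomputable def prob (p : PMF α) (q : α → Prop) : ℝ≥0∞ := expect p fun a => if q a then 1 else 0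

lemma prob_add_prob_not (p : PMF α) (q : α → Prop) : prob p q + prob p (fun a => ¬ q a) = 1 := by
  rw [prob, prob, ← expect_add]
  refine Eq.trans (congrArg _ (funext fun a => ?_)) (expect_const p 1)
  by_cases h : q a <;> simp [h]

lemma prob_mono {p : PMF α} {q q' : α → Prop} (h : ∀ a ∈ p.support, q a → q' a) :
    prob p q ≤ prob p q' := by
  refine expect_mono fun a ha => ?_
  by_cases hq : q a
  · simp [hq, h a ha hq]
  · simp [hq]

lemma prob_eq_one {p : PMF α} {q : α → Prop} (h : ∀ a ∈ p.support, q a) : prob p q = 1 := by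
  refine le_antisymm ?_ (le_expect fun a ha => by simp [h a ha])
  calc _ ≤ prob p q + prob p fun a => ¬ q a := le_self_add
    _ = 1 := prob_add_prob_not p q

lemma prob_bind (p : PMF α) (g : α → PMF β) (q : β → Prop) :
    prob (p.bind g) q = expect p fun a => prob (g a) q := expect_bind _ _ _

lemma map_apply_eq_prob (p : PMF α) (g : α → β) (b : β) :
    (p.map g) b = prob p fun a => g a = b := by
  classical
  rw [PMF.map_apply, prob, expect]
  refine tsum_congr fun a => ?_
  by_cases h : g a = b
  · simp [h]
  · simp [h, Ne.symm h]

/-- Here luck becomes probability: the set `t` has mass at least 1/κ, and outcomes outside it are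
discarded. -/
lemma le_expect_uniformOfFinset {s t : Finset α} (hs : s.Nonempty) (hts : t ⊆ s) {κ : ℕ}
    (hcard : s.card ≤ κ * t.card) {f : α → ℝ≥0∞} {c : ℝ≥0∞} (hc : ∀ a ∈ t, c ≤ f a) :
    (κ : ℝ≥0∞)⁻¹ * c ≤ expect (PMF.uniformOfFinset s hs) f := by
  have hspos : (s.card : ℝ≥0∞) ≠ 0 := by simpa using hs.ne_empty
  have h1 : ∑ a ∈ t, (s.card : ℝ≥0∞)⁻¹ * c ≤ expect (PMF.uniformOfFinset s hs) f := by
    refine le_trans ?_ (ENNReal.sum_le_tsum t)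
    refine Finset.sum_le_sum fun a ha => ?_
    rw [PMF.uniformOfFinset_apply_of_mem hs (hts ha)]
    exact mul_le_mul_right (hc a ha) _
  refine le_trans ?_ h1
  rw [Finset.sum_const, nsmul_eq_mul, ← mul_assoc]
  refine mul_le_mul_left ?_ c
  have hκ : (κ : ℝ≥0∞) ≠ 0 := by
    intro h0
    have h0' : κ = 0 := by exact_mod_cast h0
    rw [h0', zero_mul, Nat.le_zero, Finset.card_eq_zero] at hcard
    exact hs.ne_empty hcard
  rw [← div_eq_mul_inv, ENNReal.le_div_iff_mul_le (Or.inl hspos) (Or.inl (by simp)),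
    mul_comm, ← div_eq_mul_inv, ENNReal.div_le_iff hκ (by simp), mul_comm]
  exact_mod_cast hcard

end Expectation

/-! ### The exploration algorithm -/

section Algorithm

open scoped ENNReal

/-- The vertex revealed by an entry of a transcript on a graph with `n` vertices. -/
def entryVertex (n : ℕ) : Entry → Option ℕ
  | Sum.inl z => z.2
  | Sum.inr c => some (c % n)

/-- The edge revealed by an entry of a transcript. -/
def entryEdge : Entry → Option (ℕ × ℕ)
  | Sum.inl z => z.2.map fun u => (z.1, u)
  | Sum.inr _ => none

/-- The vertices revealed by a transcript. -/
def revealedVertices (n : ℕ) (tr : List Entry) : List ℕ := tr.filterMap (entryVertex n)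

/-- The edges revealed by a transcript. -/
def revealedEdges (tr : List Entry) : List (ℕ × ℕ) := tr.filterMap entryEdge

/-- The algorithm alternates between drawing a random number `c` and querying the vertex with index
`c / n` among the revealed vertices, the first of which is the random vertex `c % n`. -/
def nextAction (n w : ℕ) (tr : List Entry) : Action :=
  if tr.length % 2 = 0 then Sum.inr (Sum.inr (n * w - 1))
  else Sum.inr (Sum.inl
    ((revealedVertices n tr).getD (Sum.elim (fun _ => 0) id (tr.headI) / n) 0))

/-- Explore for `N` steps with window size `w`, then output the verdict. -/
def explorer (N : Params → ℕ) (w : ℕ) (verdict : Params × List Entry → Bool) : OracleAlgorithm :=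
  fun z => if N z.1 ≤ z.2.length then Sum.inl (verdict z) else nextAction z.1.1 w z.2

/-- The distribution of the transcript after `t` further steps. -/
noncomputable def continueRun (T : OracleAlgorithm) (x : Params) {n : ℕ} (G : SimpleGraph (Fin n)) :
    ℕ → List Entry → PMF (List Entry)
  | 0, tr => PMF.pure tr
  | t + 1, tr => (step T x G tr).bind (continueRun T x G t)

variable {T : OracleAlgorithm} {x : Params} {n : ℕ} {G : SimpleGraph (Fin n)}

lemma continueRun_add (s t : ℕ) (tr : List Entry) :
    continueRun T x G (s + t) tr = (continueRun T x G s tr).bind (continueRun T x G t) := by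
  induction s generalizing tr with
  | zero => simp [continueRun]
  | succ s ih =>
    rw [Nat.succ_add, continueRun, continueRun, PMF.bind_bind]
    exact congrArg _ (funext fun tr' => ih tr')

/-- `run` appends steps at the end, whereas induction over guesses conditions on the first step. -/
lemma run_eq_continueRun (t : ℕ) : run T x G t = continueRun T x G t [] := by
  induction t with
  | zero => rfl
  | succ t ih =>
    rw [run, continueRun_add, ih]
    congr 1
    funext tr
    simp [continueRun]

lemma continueRun_induction {P : List Entry → Prop}
    (hP : ∀ tr, P tr → ∀ tr' ∈ (step T x G tr).support, P tr') (t : ℕ) {tr tr' : List Entry}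
    (h : P tr) (h' : tr' ∈ (continueRun T x G t tr).support) : P tr' := by
  induction t generalizing tr with
  | zero =>
    rw [continueRun, PMF.support_pure, Set.mem_singleton_iff] at h'
    exact h' ▸ h
  | succ t ih =>
    rw [continueRun, PMF.mem_support_bind_iff] at h'
    obtain ⟨tr1, h1, h2⟩ := h'
    exact ih (hP tr h tr1 h1) h2

lemma oracleAnswer_eq (v : Fin n) (h : (nbrs G v).Nonempty) :
    oracleAnswer G v =
      (PMF.uniformOfFinset (nbrs G v) h).map fun u : Fin n => some (u : ℕ) := by
  classical
  have hne : ∃ hv : (v : ℕ) < n, (G.neighborFinset ⟨v, hv⟩).Nonempty := by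
    obtain ⟨u, hu⟩ := h
    exact ⟨v.2, u, by simpa using hu⟩
  have hset : G.neighborFinset v = nbrs G v := by
    ext u
    simp
  rw [oracleAnswer, dif_pos (by convert hne)]
  -- In `oracleAnswer` the distribution on `Fin n` is coerced to one on `ℕ` by a bind, which is
  -- fused here with the map.
  change PMF.map _ (PMF.bind _ fun a : Fin n => PMF.pure (a : ℕ)) = _
  rw [← PMF.bind_pure_comp, ← PMF.bind_pure_comp, PMF.bind_bind]
  simp only [PMF.pure_bind, Function.comp_apply]
  congr 2

lemma mem_support_oracleAnswer {v u : ℕ} (h : some u ∈ (oracleAnswer G v).support) :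
    ∃ (hv : v < n) (hu : u < n), G.Adj ⟨v, hv⟩ ⟨u, hu⟩ := by
  classical
  by_cases hne : ∃ hv : v < n, (nbrs G ⟨v, hv⟩).Nonempty
  · obtain ⟨hv, hne⟩ := hne
    have heq := oracleAnswer_eq ⟨v, hv⟩ hne
    simp only at heq
    rw [heq, PMF.mem_support_map_iff] at h
    obtain ⟨u', hu', he⟩ := h
    rw [PMF.mem_support_uniformOfFinset_iff, mem_nbrs] at hu'
    obtain rfl : (u' : ℕ) = u := by simpa using he
    exact ⟨hv, u'.2, hu'⟩
  · unfold oracleAnswer at h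
    rw [dif_neg] at h
    · simp at h
    · rintro ⟨hv, u', hu'⟩
      exact hne ⟨hv, u', by simpa using hu'⟩

/-- Every step of a run adds an entry that is consistent with the graph, or changes nothing. -/
lemma mem_support_step {tr tr' : List Entry} (h : tr' ∈ (step T x G tr).support) :
    (tr' = tr ∧ ∃ b, T (x, tr) = Sum.inl b) ∨
      ((∃ a, T (x, tr) = Sum.inr a) ∧ ∃ e, tr' = e :: tr ∧
      ∀ v u, e = Sum.inl (v, some u) → ∃ (hv : v < n) (hu : u < n), G.Adj ⟨v, hv⟩ ⟨u, hu⟩) := by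
  unfold step at h
  split at h
  · rename_i b hb
    rw [PMF.support_pure, Set.mem_singleton_iff] at h
    exact Or.inl ⟨h, b, hb⟩
  · rename_i v hv
    rw [PMF.mem_support_map_iff] at h
    obtain ⟨a, ha, rfl⟩ := h
    refine Or.inr ⟨⟨_, hv⟩, _, rfl, ?_⟩
    intro v' u he
    obtain ⟨rfl, rfl⟩ : v = v' ∧ a = some u := by simpa using he
    exact mem_support_oracleAnswer ha
  · rename_i m hm
    rw [PMF.mem_support_map_iff] at h
    obtain ⟨c, -, rfl⟩ := h
    exact Or.inr ⟨⟨_, hm⟩, _, rfl, by simp⟩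

section Explorer

variable {N : Params → ℕ} {w : ℕ} {verdict : Params × List Entry → Bool}

lemma explorer_halted {tr : List Entry} (h : N x ≤ tr.length) :
    explorer N w verdict (x, tr) = Sum.inl (verdict (x, tr)) := if_pos h

lemma explorer_running {tr : List Entry} (h : tr.length < N x) :
    explorer N w verdict (x, tr) = nextAction x.1 w tr := if_neg (not_le.2 h)

lemma exists_nextAction_eq (n w : ℕ) (tr : List Entry) : ∃ a, nextAction n w tr = Sum.inr a := by
  unfold nextAction
  split_ifs
  exacts [⟨_, rfl⟩, ⟨_, rfl⟩]

lemma length_of_mem_support (t : ℕ) {tr tr' : List Entry}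
    (ht : tr.length + t ≤ N x) (h : tr' ∈ (continueRun (explorer N w verdict) x G t tr).support) :
    tr'.length = tr.length + t := by
  induction t generalizing tr with
  | zero =>
    rw [continueRun, PMF.support_pure, Set.mem_singleton_iff] at h
    simp [h]
  | succ t ih =>
    rw [continueRun, PMF.mem_support_bind_iff] at h
    obtain ⟨tr1, h1, h2⟩ := h
    rcases mem_support_step h1 with ⟨-, b, hb⟩ | ⟨-, e, rfl, -⟩
    · rw [explorer_running (by omega)] at hb
      obtain ⟨a, ha⟩ := exists_nextAction_eq x.1 w tr
      rw [ha] at hb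
      exact absurd hb (by simp)
    · have := ih (by simp; omega) h2
      simp only [List.length_cons] at this
      omega

lemma length_le_of_mem_support_run (t : ℕ) {tr : List Entry}
    (h : tr ∈ (run (explorer N w verdict) x G t).support) : tr.length ≤ N x := by
  rw [run_eq_continueRun] at h
  refine continueRun_induction (P := fun tr => tr.length ≤ N x) ?_ t (by simp) h
  intro tr htr tr' htr'
  rcases mem_support_step htr' with ⟨rfl, -⟩ | ⟨⟨a, ha⟩, e, rfl, -⟩
  · exact htr
  · have : tr.length < N x := by
      by_contra! hcon
      rw [explorer_halted hcon] at ha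
      exact absurd ha (by simp)
    simpa using this

/-- Soundness, the source of one-sided error: oracle answers are genuine neighbours and random draws
reveal no edges. -/
lemma edges_of_mem_support_run (t : ℕ) {tr : List Entry}
    (h : tr ∈ (run T x G t).support) :
    ∀ v u, (v, u) ∈ revealedEdges tr → ∃ (hv : v < n) (hu : u < n), G.Adj ⟨v, hv⟩ ⟨u, hu⟩ := by
  rw [run_eq_continueRun] at h
  refine continueRun_induction (P := fun tr => ∀ v u, (v, u) ∈ revealedEdges tr →
    ∃ (hv : v < n) (hu : u < n), G.Adj ⟨v, hv⟩ ⟨u, hu⟩) ?_ t (by simp [revealedEdges]) h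
  intro tr htr tr' htr' v u hvu
  rcases mem_support_step htr' with ⟨rfl, -⟩ | ⟨-, e, rfl, he⟩
  · exact htr v u hvu
  · rw [revealedEdges, List.filterMap_cons] at hvu
    split at hvu
    · exact htr v u hvu
    · rename_i b hb
      rcases List.mem_cons.1 hvu with rfl | hvu
      · refine he v u ?_
        rcases e with ⟨v', _ | u'⟩ | c
        · simp [entryEdge] at hb
        · simp only [entryEdge, Option.map_some, Option.some.injEq, Prod.mk.injEq] at hb
          rw [hb.1, hb.2]
        · simp [entryEdge] at hb
      · exact htr v u hvu

lemma halts_explorer : Halts (explorer N w verdict) x G := by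
  refine ⟨N x, fun tr htr => ⟨_, explorer_halted ?_⟩⟩
  rw [run_eq_continueRun] at htr
  have := length_of_mem_support (N x) (by simp) htr
  simp only [List.length_nil] at this
  omega

lemma queriesAtMost_explorer : QueriesAtMost (explorer N w verdict) x G (N x) :=
  fun t _ htr => List.countP_le_length.trans (length_le_of_mem_support_run t htr)

lemma prob_verdict_le (b : Bool) :
    prob (run (explorer N w verdict) x G (N x)) (fun tr => verdict (x, tr) = b) ≤
      verdictProb (explorer N w verdict) x G b := by
  refine le_trans ?_ (le_iSup (fun t => ((run (explorer N w verdict) x G t).map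
    fun tr => explorer N w verdict (x, tr)) (Sum.inl b)) (N x))
  rw [map_apply_eq_prob]
  refine prob_mono fun tr htr hb => ?_
  rw [run_eq_continueRun] at htr
  have := length_of_mem_support (N x) (by simp) htr
  rw [explorer_halted (by simp at this; omega), hb]

lemma verdictProb_le_one (b : Bool) : verdictProb T x G b ≤ 1 :=
  iSup_le fun _ => PMF.coe_le_one _ _

end Explorer

end Algorithm

/-! ### The success probability of the exploration -/

section Success

open scoped ENNReal

/-- The transcript `tr` reveals everything in `s`; the vertices are among the first `m` ones. -/
def Reveals {n : ℕ} (tr : List Entry) (m : ℕ) (s : Knowledge (Fin n)) : Prop :=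
  (∀ v ∈ s.1, ∃ i < m, (revealedVertices n tr)[i]? = some (v : ℕ)) ∧
    ∀ e ∈ s.2, ∃ v u : Fin n, e = s(v, u) ∧ ((v : ℕ), (u : ℕ)) ∈ revealedEdges tr

variable {n : ℕ} {G : SimpleGraph (Fin n)}

lemma revealedVertices_two (q : ℕ) (a : Option ℕ) (c : ℕ) (tr : List Entry) :
    revealedVertices n (Sum.inl (q, a) :: Sum.inr c :: tr) =
      a.toList ++ c % n :: revealedVertices n tr := by
  cases a <;> simp [revealedVertices, List.filterMap_cons, entryVertex]

lemma revealedEdges_two (q : ℕ) (a : Option ℕ) (c : ℕ) (tr : List Entry) :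
    revealedEdges (Sum.inl (q, a) :: Sum.inr c :: tr) =
      (a.map fun u => (q, u)).toList ++ revealedEdges tr := by
  cases a <;> simp [revealedEdges, List.filterMap_cons, entryEdge]

/-- A draw and a query prepend one or two vertices, so old indices shift by at most two. -/
lemma Reveals.two {tr : List Entry} {m : ℕ} {s : Knowledge (Fin n)} (h : Reveals tr m s)
    (q : ℕ) (a : Option ℕ) (c : ℕ) :
    Reveals (Sum.inl (q, a) :: Sum.inr c :: tr) (m + 2) s := by
  constructor
  · intro v hv
    obtain ⟨i, hi, hvi⟩ := h.1 v hv
    rw [revealedVertices_two]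
    cases a with
    | none => exact ⟨i + 1, by omega, by simpa using hvi⟩
    | some u => exact ⟨i + 2, by omega, by simpa using hvi⟩
  · intro e he
    obtain ⟨v, u, rfl, hvu⟩ := h.2 e he
    exact ⟨v, u, rfl, by rw [revealedEdges_two]; exact List.mem_append_right _ hvu⟩

lemma Reveals.insert_vertex {tr : List Entry} {m : ℕ} {s : Knowledge (Fin n)}
    (h : Reveals tr m s) {u : Fin n} (hu : ∃ i < m, (revealedVertices n tr)[i]? = some (u : ℕ)) :
    Reveals tr m (insert u s.1, s.2) := by
  refine ⟨fun v hv => ?_, h.2⟩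
  rcases hv with rfl | hv
  exacts [hu, h.1 v hv]

lemma Reveals.insert_edge {tr : List Entry} {m : ℕ} {s : Knowledge (Fin n)}
    (h : Reveals tr m s) {v u : Fin n} (hvu : ((v : ℕ), (u : ℕ)) ∈ revealedEdges tr) :
    Reveals tr m (s.1, insert s(v, u) s.2) := by
  refine ⟨h.1, fun e he => ?_⟩
  rcases he with rfl | he
  exacts [⟨v, u, rfl, hvu⟩, h.2 e he]

/-- At least `|S| w` of `n w` numbers have their remainder in `S`. -/
lemma card_filter_mod (hn : 0 < n) (w M : ℕ) (hM : M = n * w) (S : Finset (Fin n)) :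
    S.card * w ≤ ((Finset.univ : Finset (Fin M)).filter fun c : Fin M => ∃ u ∈ S, (u : ℕ) = c % n).card := by
  classical
  have hcard : S.card * w = (S ×ˢ (Finset.univ : Finset (Fin w))).card := by simp
  rw [hcard]
  have hlt : ∀ z : Fin n × Fin w, (z.1 : ℕ) + n * z.2 < M := by
    intro z
    have h1 := z.1.2
    have h2 : n * (z.2 + 1) ≤ n * w := Nat.mul_le_mul_left n z.2.2
    rw [Nat.mul_add, mul_one] at h2
    omega
  refine Finset.card_le_card_of_injOn (fun z => ⟨z.1 + n * z.2, hlt z⟩) ?_ ?_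
  · intro z hz
    have hz1 := (Finset.mem_product.1 (Finset.mem_coe.1 hz)).1
    refine Finset.mem_coe.2 (Finset.mem_filter.2 ⟨Finset.mem_univ _, z.1, hz1, ?_⟩)
    simp [Nat.add_mul_mod_self_left, Nat.mod_eq_of_lt z.1.2]
  · intro z _ z' _ he
    have he' : (z.1 : ℕ) + n * z.2 = z'.1 + n * z'.2 := by simpa using congrArg Fin.val he
    have h1 : (z.1 : ℕ) = z'.1 := by
      have := congrArg (· % n) he'
      simpa [Nat.add_mul_mod_self_left, Nat.mod_eq_of_lt z.1.2, Nat.mod_eq_of_lt z'.1.2] using this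
    have h2 : (z.2 : ℕ) = z'.2 := by
      rw [h1] at he'
      exact Nat.eq_of_mul_eq_mul_left hn (Nat.add_left_cancel he')
    exact Prod.ext (Fin.ext h1) (Fin.ext h2)

/-- At least `n` of `n w` numbers have the quotient `i` for given `i < w`. -/
lemma le_card_filter_div (w M i : ℕ) (hM : M = n * w) (hi : i < w) :
    n ≤ ((Finset.univ : Finset (Fin M)).filter fun c : Fin M => (c : ℕ) / n = i).card := by
  classical
  have hlt : ∀ r : Fin n, (r : ℕ) + n * i < M := by
    intro r
    have h1 := r.2
    have h2 : n * (i + 1) ≤ n * w := Nat.mul_le_mul_left n hi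
    rw [Nat.mul_add, mul_one] at h2
    omega
  calc n = (Finset.univ : Finset (Fin n)).card := by simp
    _ ≤ _ := by
      refine Finset.card_le_card_of_injOn (fun r => ⟨r + n * i, hlt r⟩) ?_ ?_
      · intro r _
        refine Finset.mem_coe.2 (Finset.mem_filter.2 ⟨Finset.mem_univ _, ?_⟩)
        have hn : 0 < n := lt_of_le_of_lt (Nat.zero_le _) r.2
        simp [Nat.add_mul_div_left _ _ hn, Nat.div_eq_of_lt r.2]
      · intro r _ r' _ he
        have he' : (r : ℕ) + n * i = r' + n * i := by simpa using congrArg Fin.val he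
        exact Fin.ext (Nat.add_right_cancel he')

variable {N : Params → ℕ} {w : ℕ} {verdict : Params × List Entry → Bool} {x : Params}

lemma le_expect_step_draw (hx : x.1 = n) {tr : List Entry} (hlen : tr.length < N x)
    (heven : tr.length % 2 = 0) {κ : ℕ} {f : List Entry → ℝ≥0∞} {δ : ℝ≥0∞}
    (t : Finset (Fin (n * w - 1 + 1))) (hcard : n * w - 1 + 1 ≤ κ * t.card)
    (ht : ∀ c ∈ t, δ ≤ f (Sum.inr (c : ℕ) :: tr)) :
    (κ : ℝ≥0∞)⁻¹ * δ ≤ expect (step (explorer N w verdict) x G tr) f := by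
  have hT : explorer N w verdict (x, tr) = Sum.inr (Sum.inr (n * w - 1)) := by
    rw [explorer_running hlen, nextAction, if_pos heven, hx]
  simp only [step, hT]
  change _ ≤ expect (PMF.map _ (PMF.bind (PMF.uniformOfFintype (Fin (n * w - 1 + 1)))
    fun c => PMF.pure (c : ℕ))) f
  rw [expect_map, expect_bind]
  simp only [expect_pure]
  refine le_expect_uniformOfFinset (Finset.univ_nonempty) (Finset.subset_univ t) ?_ ht
  simpa using hcard

/-- The drawn vertex enters the list before the query, so quotient 0 selects it and quotient i + 1
selects the previous i-th vertex. -/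
lemma step_query (hx : x.1 = n) {tr : List Entry} {c : ℕ} (hlen : tr.length + 1 < N x)
    (heven : tr.length % 2 = 0) :
    step (explorer N w verdict) x G (Sum.inr c :: tr) =
      (oracleAnswer G ((c % n :: revealedVertices n tr).getD (c / n) 0)).map fun a =>
        Sum.inl ((c % n :: revealedVertices n tr).getD (c / n) 0, a) :: Sum.inr c :: tr := by
  have hT : explorer N w verdict (x, Sum.inr c :: tr) =
      Sum.inr (Sum.inl ((c % n :: revealedVertices n tr).getD (c / n) 0)) := by
    rw [explorer_running (by simpa using hlen), nextAction, if_neg (by simp; omega), hx]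
    simp [revealedVertices, entryVertex]
  simp only [step, hT]

/-- A goal within reach is attained with a probability that does not depend on the graph. -/
lemma le_prob_continueRun (hx : x.1 = n) (hn : 0 < n) {κ : ℕ} (hκ : 0 < κ) (hw0 : 0 < w)
    {goal : Knowledge (Fin n) → Prop} {good : List Entry → Prop}
    (hcons : ∀ e tr, good tr → good (e :: tr))
    (hgood : ∀ tr m s, Reveals tr m s → goal s → good tr)
    {j m : ℕ} {s : Knowledge (Fin n)} {tr : List Entry} (hreach : CanReach G κ goal j s)
    (hrev : Reveals tr m s) (hw : m + 2 * j ≤ w) (hlen : tr.length + 2 * j ≤ N x)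
    (heven : tr.length % 2 = 0) :
    ((κ * w : ℕ) : ℝ≥0∞)⁻¹ ^ j ≤
      prob (continueRun (explorer N w verdict) x G (2 * j) tr) good := by
  have hle1 : ((κ * w : ℕ) : ℝ≥0∞)⁻¹ ≤ 1 := by
    rw [ENNReal.inv_le_one]
    exact_mod_cast Nat.mul_pos hκ hw0
  have hdone : ∀ {j : ℕ} {s : Knowledge (Fin n)} {tr : List Entry} {m : ℕ}, goal s →
      Reveals tr m s → ((κ * w : ℕ) : ℝ≥0∞)⁻¹ ^ j ≤
        prob (continueRun (explorer N w verdict) x G (2 * j) tr) good := by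
    intro j s tr m hg hr
    rw [prob_eq_one]
    · exact pow_le_one₀ zero_le hle1
    · intro tr' htr'
      refine continueRun_induction (P := good) ?_ _ (hgood tr m s hr hg) htr'
      intro tr htr tr' htr'
      rcases mem_support_step htr' with ⟨rfl, -⟩ | ⟨-, e, rfl, -⟩
      exacts [htr, hcons e tr htr]
  induction j generalizing m s tr with
  | zero => exact hdone hreach hrev
  | succ j ih =>
    rcases hreach with hg | ⟨S, hS, hreach⟩ | ⟨v, hv, S, hSv, hne, hS, hreach⟩
    · exact hdone hg hrev
    · rw [show 2 * (j + 1) = 2 * j + 1 + 1 by ring, continueRun, prob_bind, pow_succ']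
      have hM : n * w - 1 + 1 = n * w := Nat.sub_add_cancel (Nat.mul_pos hn hw0)
      rw [Fintype.card_fin] at hS
      have hcount := card_filter_mod hn w (n * w - 1 + 1) hM S
      refine le_expect_step_draw hx (by omega) heven
        (Finset.univ.filter fun c : Fin (n * w - 1 + 1) => ∃ u ∈ S, (u : ℕ) = c % n) ?_ ?_
      · rw [hM]
        rw [hM] at hcount
        calc n * w ≤ κ * S.card * w := Nat.mul_le_mul_right w hS
          _ = κ * (S.card * w) := by ring
          _ ≤ κ * _ := Nat.mul_le_mul_left κ hcount
          _ ≤ κ * w * _ := Nat.mul_le_mul_right _ (Nat.le_mul_of_pos_right κ hw0)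
      · intro c hc
        obtain ⟨u, huS, hu⟩ := (Finset.mem_filter.1 hc).2
        rw [continueRun, prob_bind]
        refine le_expect fun tr2 htr2 => ?_
        rw [step_query hx (by omega) heven, PMF.mem_support_map_iff] at htr2
        obtain ⟨a, -, rfl⟩ := htr2
        refine ih (m := m + 2) (hreach u huS) ((hrev.two _ a c).insert_vertex ?_) (by omega)
          (by simp only [List.length_cons]; omega) (by simp only [List.length_cons]; omega)
        rw [revealedVertices_two]
        cases a with
        | none => exact ⟨0, by omega, by simp [hu]⟩
        | some u' => exact ⟨1, by omega, by simp [hu]⟩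
    · rw [show 2 * (j + 1) = 2 * j + 1 + 1 by ring, continueRun, prob_bind, pow_succ']
      have hM : n * w - 1 + 1 = n * w := Nat.sub_add_cancel (Nat.mul_pos hn hw0)
      obtain ⟨i, him, hvi⟩ := hrev.1 v hv
      -- For a random neighbour, 1/w pays for a draw whose quotient selects `v`, and 1/κ pays for a
      -- lucky oracle answer.
      have hcount := le_card_filter_div (n := n) w (n * w - 1 + 1) (i + 1) hM (by omega)
      have hinv : ((κ * w : ℕ) : ℝ≥0∞)⁻¹ = (w : ℝ≥0∞)⁻¹ * (κ : ℝ≥0∞)⁻¹ := by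
        rw [Nat.cast_mul, ENNReal.mul_inv (by simp) (by simp), mul_comm]
      rw [hinv, mul_assoc, ← hinv]
      refine le_expect_step_draw hx (by omega) heven
        (Finset.univ.filter fun c : Fin (n * w - 1 + 1) => (c : ℕ) / n = i + 1) ?_ ?_
      · rw [hM]
        rw [hM] at hcount
        exact (mul_comm n w).trans_le (Nat.mul_le_mul_left w hcount)
      · intro c hc
        have hci := (Finset.mem_filter.1 hc).2
        rw [continueRun, prob_bind, step_query hx (by omega) heven]
        have hq : ((c : ℕ) % n :: revealedVertices n tr).getD (c / n) 0 = v := by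
          rw [hci, List.getD_eq_getElem?_getD, List.getElem?_cons_succ, hvi, Option.getD_some]
        rw [hq, oracleAnswer_eq v (hne.mono hSv), expect_map, expect_map]
        refine le_expect_uniformOfFinset _ hSv hS fun u hu => ?_
        have h2 := hrev.two (v : ℕ) (some (u : ℕ)) c
        refine ih (m := m + 2) (hreach u hu)
          ((h2.insert_edge (v := v) (u := u) ?_).insert_vertex (u := u) ?_) (by omega)
          (by simp only [List.length_cons]; omega) (by simp only [List.length_cons]; omega)
        · rw [revealedEdges_two]
          simp
        · rw [revealedVertices_two]
          exact ⟨0, by omega, by simp⟩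

/-- Repeating independent rounds makes failure unlikely. -/
lemma prob_not_good_le {good : List Entry → Prop} (hcons : ∀ e tr, good tr → good (e :: tr))
    {J : ℕ} {δ : ℝ≥0∞} (hδ : ∀ tr : List Entry, tr.length % 2 = 0 → tr.length + 2 * J ≤ N x →
      δ ≤ prob (continueRun (explorer N w verdict) x G (2 * J) tr) good)
    (i : ℕ) {tr : List Entry} (heven : tr.length % 2 = 0) (hlen : tr.length + 2 * J * i ≤ N x) :
    prob (continueRun (explorer N w verdict) x G (2 * J * i) tr) (fun tr => ¬ good tr) ≤
      (1 - δ) ^ i := by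
  classical
  have hpersist : ∀ (t : ℕ) {tr tr' : List Entry}, good tr →
      tr' ∈ (continueRun (explorer N w verdict) x G t tr).support → good tr' := by
    intro t tr tr' h h'
    refine continueRun_induction (P := good) ?_ t h h'
    intro tr htr tr' htr'
    rcases mem_support_step htr' with ⟨rfl, -⟩ | ⟨-, e, rfl, -⟩
    exacts [htr, hcons e tr htr]
  induction i generalizing tr with
  | zero =>
    rw [pow_zero, ← prob_add_prob_not (continueRun (explorer N w verdict) x G (2 * J * 0) tr) good]
    exact le_add_self
  | succ i ih =>
    have hJ : 2 * J * (i + 1) = 2 * J + 2 * J * i := by ring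
    rw [hJ] at hlen ⊢
    rw [continueRun_add, prob_bind, pow_succ']
    have hround : prob (continueRun (explorer N w verdict) x G (2 * J) tr) (fun tr => ¬ good tr) ≤
        1 - δ := by
      have h1 := prob_add_prob_not (continueRun (explorer N w verdict) x G (2 * J) tr) good
      have h2 := hδ tr heven (by omega)
      refine ENNReal.le_sub_of_add_le_left (ne_top_of_le_ne_top ENNReal.one_ne_top
        (h2.trans (h1 ▸ le_self_add))) ?_
      rw [← h1]
      exact add_le_add_left h2 _
    -- Success persists, so only a failed first round contributes, and the bound for the remaining
    -- rounds holds from any transcript.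
    refine le_trans ?_ (mul_le_mul_left hround _)
    rw [prob, ← expect_mul_right]
    refine expect_mono fun tr' htr' => ?_
    by_cases hg : good tr'
    · have h0 : prob (continueRun (explorer N w verdict) x G (2 * J * i) tr')
          (fun tr => ¬ good tr) ≤ 0 := by
        calc _ ≤ prob (continueRun (explorer N w verdict) x G (2 * J * i) tr') (fun _ => False) :=
              prob_mono fun tr'' h'' hb => hb (hpersist _ hg h'')
          _ = 0 := by simp [prob, expect]
      simpa [hg] using h0
    · have hl := length_of_mem_support (2 * J) (by omega) htr'
      simpa [hg] using ih (tr := tr') (by omega) (by omega)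

/-- By 1 + x ≤ eˣ the left side is at most e⁻², and the same inequality gives e² ≥ 3. -/
lemma one_sub_inv_pow_le (Q : ℕ) (hQ : 0 < Q) : (1 - (Q : ℝ≥0∞)⁻¹) ^ (2 * Q) ≤ 3⁻¹ := by
  have hQ' : (0 : ℝ) < Q := by exact_mod_cast hQ
  have h1 : 1 - (Q : ℝ≥0∞)⁻¹ = ENNReal.ofReal (1 - (Q : ℝ)⁻¹) := by
    rw [ENNReal.ofReal_sub _ (by positivity), ENNReal.ofReal_one, ENNReal.ofReal_inv_of_pos hQ',
      ENNReal.ofReal_natCast]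
  have h0 : 0 ≤ 1 - (Q : ℝ)⁻¹ := sub_nonneg.2 (inv_le_one_of_one_le₀ (by exact_mod_cast hQ))
  have h2 : (1 - (Q : ℝ)⁻¹) ^ (2 * Q) ≤ 3⁻¹ := by
    calc _ ≤ (Real.exp (-(Q : ℝ)⁻¹)) ^ (2 * Q) := by
          gcongr
          have := Real.add_one_le_exp (-(Q : ℝ)⁻¹)
          linarith
      _ = (Real.exp 2)⁻¹ := by
          rw [← Real.exp_nat_mul, ← Real.exp_neg]
          congr 1
          push_cast
          field_simp
      _ ≤ 3⁻¹ := by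
          gcongr
          have := Real.add_one_le_exp (2 : ℝ)
          linarith
  rw [h1, ← ENNReal.ofReal_pow h0]
  refine (ENNReal.ofReal_le_ofReal h2).trans_eq ?_
  rw [ENNReal.ofReal_inv_of_pos (by norm_num)]
  norm_num

/-- If a goal is within reach, then the exploration attains it with probability `2 / 3`. -/
theorem two_thirds_le_prob (hx : x.1 = n) (hn : 0 < n) {κ J : ℕ} (hκ : 0 < κ)
    {goal : Knowledge (Fin n) → Prop} {good : List Entry → Prop}
    (hcons : ∀ e tr, good tr → good (e :: tr))
    (hgood : ∀ tr m s, Reveals tr m s → goal s → good tr)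
    (hreach : CanReach G κ goal J (∅, ∅)) (hw0 : 0 < w) (hw : 2 * J ≤ w)
    (hN : N x = 2 * J * (2 * (κ * w) ^ J)) :
    2 / 3 ≤ prob (run (explorer N w verdict) x G (N x)) good := by
  have hQ : 0 < (κ * w) ^ J := Nat.pow_pos (Nat.mul_pos hκ hw0)
  have hbad := prob_not_good_le (G := G) (N := N) (w := w) (verdict := verdict) (x := x) hcons
    (J := J) (δ := (((κ * w) ^ J : ℕ) : ℝ≥0∞)⁻¹) (fun tr heven hlen => by
      have := le_prob_continueRun (verdict := verdict) hx hn hκ hw0 hcons hgood (m := 0) (tr := tr)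
        hreach ⟨by simp, by simp⟩ (by omega) hlen heven
      rwa [Nat.cast_pow, ENNReal.inv_pow]) (2 * (κ * w) ^ J) (tr := []) (by simp)
    (by simp [hN])
  rw [← hN, ← run_eq_continueRun] at hbad
  have hle := hbad.trans (one_sub_inv_pow_le _ hQ)
  have hsum := prob_add_prob_not (run (explorer N w verdict) x G (N x)) good
  have h3 : (2 / 3 : ℝ≥0∞) + 3⁻¹ = 1 := by
    rw [div_eq_mul_inv, ← add_one_mul, show (2 : ℝ≥0∞) + 1 = 3 by norm_num,
      ENNReal.mul_inv_cancel (by simp) (by simp)]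
  have h4 : (2 / 3 : ℝ≥0∞) + 3⁻¹ ≤ prob (run (explorer N w verdict) x G (N x)) good + 3⁻¹ := by
    rw [h3, ← hsum]
    exact add_le_add_right hle _
  exact (ENNReal.add_le_add_iff_right (by simp)).1 h4

end Success

/-! ### The verdict -/

section Verdict

/-- The edge list `E` contains a copy of `H` on vertices below `n`, given as a list. -/
def IsCopyList {k : ℕ} (H : SimpleGraph (Fin k)) (E : List (ℕ × ℕ)) (l : List ℕ) : Prop :=
  ∀ i j : Fin k, (i ≠ j → l.getD i 0 ≠ l.getD j 0) ∧
    (H.Adj i j → (l.getD i 0, l.getD j 0) ∈ E ∨ (l.getD j 0, l.getD i 0) ∈ E)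

/-- The edge list `E` contains a copy of `H` with vertices below `n`. -/
def ContainsCopy {k : ℕ} (H : SimpleGraph (Fin k)) (n : ℕ) (E : List (ℕ × ℕ)) : Prop :=
  ∃ l : List ℕ, l.length = k ∧ (∀ v ∈ l, v < n) ∧ IsCopyList H E l

variable {k n : ℕ} {H : SimpleGraph (Fin k)} {E : List (ℕ × ℕ)}

lemma ContainsCopy.mono {E' : List (ℕ × ℕ)} (h : ContainsCopy H n E) (hE : E ⊆ E') :
    ContainsCopy H n E' := by
  obtain ⟨l, h1, h2, h3⟩ := h
  exact ⟨l, h1, h2, fun i j => ⟨(h3 i j).1, fun hij => ((h3 i j).2 hij).imp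
    (fun h => hE h) (fun h => hE h)⟩⟩

lemma ContainsCopy.isContained (h : ContainsCopy H n E) {G : SimpleGraph (Fin n)}
    (hE : ∀ v u, (v, u) ∈ E → ∃ (hv : v < n) (hu : u < n), G.Adj ⟨v, hv⟩ ⟨u, hu⟩) :
    H.IsContained G := by
  obtain ⟨l, h1, h2, h3⟩ := h
  have hlt : ∀ i : Fin k, l.getD i 0 < n := by
    intro i
    rw [List.getD_eq_getElem _ _ (by omega)]
    exact h2 _ (List.getElem_mem _)
  refine ⟨⟨⟨fun i => ⟨l.getD i 0, hlt i⟩, fun {i j} hij => ?_⟩, fun i j he => ?_⟩⟩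
  · rcases (h3 i j).2 hij with h | h
    · exact (hE _ _ h).2.2
    · exact (hE _ _ h).2.2.symm
  · by_contra hne
    exact (h3 i j).1 hne (congrArg Fin.val he)

/-- The exploration controls only the non-isolated vertices of `H`; as k ≤ n, the isolated ones can
be placed on arbitrary unused vertices. -/
lemma containsCopy_of_injOn (hkn : k ≤ n) (f : Fin k → Fin n)
    (hinj : ∀ x y x' y', H.Adj x y → H.Adj x' y' → f x = f x' → x = x')
    (hE : ∀ x y, H.Adj x y → ((f x : ℕ), (f y : ℕ)) ∈ E ∨ ((f y : ℕ), (f x : ℕ)) ∈ E) :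
    ContainsCopy H n E := by
  classical
  let s : Finset (Fin k) := Finset.univ.filter fun x => ∃ y, H.Adj x y
  have hs : Set.InjOn f s := by
    intro x hx x' hx' he
    obtain ⟨y, hy⟩ := (Finset.mem_filter.1 (Finset.mem_coe.1 hx)).2
    obtain ⟨y', hy'⟩ := (Finset.mem_filter.1 (Finset.mem_coe.1 hx')).2
    exact hinj x y x' y' hy hy' he
  obtain ⟨t, hst, htc⟩ := Finset.exists_superset_card_eq (s := s.image f) (n := k)
    (Finset.card_image_le.trans (by simpa using Finset.card_le_univ s)) (by simpa using hkn)
  obtain ⟨g, hg⟩ := Finset.exists_equiv_extend_of_card_eq (t := t) (by simp [htc]) hst hs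
  have hgf : ∀ x y, H.Adj x y → (g x : Fin n) = f x := fun x y hxy =>
    hg x (Finset.mem_filter.2 ⟨Finset.mem_univ x, y, hxy⟩)
  have hget : ∀ i : Fin k, (List.ofFn fun i => ((g i : Fin n) : ℕ)).getD i 0 = (g i : Fin n) := by
    intro i
    rw [List.getD_eq_getElem _ _ (by simp)]
    simp
  refine ⟨List.ofFn fun i => ((g i : Fin n) : ℕ), by simp, ?_, fun i j => ⟨?_, ?_⟩⟩
  · intro v hv
    rw [List.mem_ofFn] at hv
    obtain ⟨i, rfl⟩ := hv
    exact (g i : Fin n).2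
  · rw [hget, hget]
    exact fun hij he => hij (g.injective (Subtype.ext (Fin.ext he)))
  · intro hij
    rw [hget, hget, hgf i j hij, hgf j i hij.symm]
    exact hE i j hij

end Verdict

/-! ### Computability -/

section Computability

variable {α : Type*} [Primcodable α]

lemma primrecPred_forall_finset {ι : Type*} (s : Finset ι) {P : ι → α → Prop}
    (h : ∀ i, PrimrecPred (P i)) : PrimrecPred fun a => ∀ i ∈ s, P i a := by
  classical
  induction s using Finset.induction_on with
  | empty => exact ⟨fun _ => .isTrue (by simp), (Primrec.const true).of_eq fun _ => by simp⟩
  | insert i s _ ih => exact ((h i).and ih).of_eq fun a => by simp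

lemma primrecPred_forall_fintype {ι : Type*} [Fintype ι] {P : ι → α → Prop}
    (h : ∀ i, PrimrecPred (P i)) : PrimrecPred fun a => ∀ i, P i a :=
  (primrecPred_forall_finset Finset.univ h).of_eq fun a => by simp

lemma primrecPred_const_imp (c : Prop) {P : α → Prop} (h : PrimrecPred P) :
    PrimrecPred fun a => c → P a := by
  by_cases hc : c
  · exact h.of_eq fun a => by simp [hc]
  -- Quantifying over the empty set supplies the constantly true predicate.
  · exact (primrecPred_forall_finset (∅ : Finset ℕ) fun _ => h).of_eq fun a => by simp [hc]

lemma primrecPred_exists_list {P : List ℕ × ℕ × α → Prop} (hP : PrimrecPred P) (j : ℕ) :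
    PrimrecPred fun z : List ℕ × ℕ × α =>
      ∃ l : List ℕ, l.length = j ∧ (∀ v ∈ l, v < z.2.1) ∧ P (l ++ z.1, z.2) := by
  induction j with
  | zero => exact hP.of_eq fun z => by simp [List.length_eq_zero_iff]
  | succ j ih =>
    -- The list is guessed from its end: the last entry `v` moves into the suffix already fixed, by
    -- bounded quantification over `v`.
    have hR : PrimrecRel fun (v : ℕ) (z : List ℕ × ℕ × α) =>
        ∃ l : List ℕ, l.length = j ∧ (∀ u ∈ l, u < z.2.1) ∧ P (l ++ v :: z.1, z.2) :=
      ih.comp (f := fun y : ℕ × List ℕ × ℕ × α => (y.1 :: y.2.1, y.2.2))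
        ((Primrec.list_cons.comp Primrec.fst (Primrec.fst.comp Primrec.snd)).pair
          (Primrec.snd.comp Primrec.snd))
    have hex := hR.exists_mem_list.comp
      (Primrec.list_range.comp (Primrec.fst.comp (Primrec.snd (α := List ℕ) (β := ℕ × α))))
      Primrec.id
    refine hex.of_eq fun z => ?_
    constructor
    · rintro ⟨v, hv, l, hl, hlt, hp⟩
      refine ⟨l ++ [v], by simp [hl], ?_, by simpa using hp⟩
      intro u hu
      rcases List.mem_append.1 hu with hu | hu
      · exact hlt u hu
      · rw [List.mem_singleton.1 hu]; simpa using hv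
    · rintro ⟨l, hl, hlt, hp⟩
      obtain ⟨l', v, rfl⟩ : ∃ l' v, l = l' ++ [v] := by
        rcases List.eq_nil_or_concat l with rfl | ⟨l', v, rfl⟩
        · simp at hl
        · exact ⟨l', v, by simp⟩
      exact ⟨v, by simpa using hlt v (by simp), l', by simpa using hl,
        fun u hu => hlt u (by simp [hu]), by simpa using hp⟩

lemma primrecPred_mem_list {f : α → ℕ × ℕ} {E : α → List (ℕ × ℕ)} (hf : Primrec f)
    (hE : Primrec E) : PrimrecPred fun a => f a ∈ E a :=
  ((PrimrecRel.exists_mem_list (R := fun a b : ℕ × ℕ => a = b) Primrec.eq).comp hE hf).of_eq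
    fun a => by simp

/-- As `H` is fixed, the test is a search over lists of constant length for a finite conjunction of
comparisons. -/
lemma primrecPred_containsCopy {k : ℕ} (H : SimpleGraph (Fin k)) :
    PrimrecPred fun z : ℕ × List (ℕ × ℕ) => ContainsCopy H z.1 z.2 := by
  have hget : ∀ i : Fin k, Primrec fun z : List ℕ × ℕ × List (ℕ × ℕ) => z.1.getD i 0 :=
    fun i => (Primrec.list_getD 0).comp Primrec.fst (Primrec.const (i : ℕ))
  have hE : Primrec fun z : List ℕ × ℕ × List (ℕ × ℕ) => z.2.2 := Primrec.snd.comp Primrec.snd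
  have hP : PrimrecPred fun z : List ℕ × ℕ × List (ℕ × ℕ) => IsCopyList H z.2.2 z.1 := by
    refine primrecPred_forall_fintype fun i => primrecPred_forall_fintype fun j =>
      (primrecPred_const_imp _ ?_).and (primrecPred_const_imp _ ?_)
    · exact (Primrec.eq.comp (hget i) (hget j)).not
    · exact (primrecPred_mem_list ((hget i).pair (hget j)) hE).or
        (primrecPred_mem_list ((hget j).pair (hget i)) hE)
  have := (primrecPred_exists_list hP k).comp
    (f := fun z : ℕ × List (ℕ × ℕ) => (([] : List ℕ), z)) ((Primrec.const []).pair Primrec.id)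
  refine this.of_eq fun z => ?_
  simp [ContainsCopy]

lemma primrec_revealedVertices : Primrec₂ revealedVertices := by
  refine Primrec.listFilterMap Primrec.snd (g := fun (z : ℕ × List Entry) e => entryVertex z.1 e) ?_
  have h : Primrec fun y : (ℕ × List Entry) × Entry =>
      Sum.elim (fun z : ℕ × Option ℕ => z.2) (fun c => some (c % y.1.1)) y.2 := by
    refine (Primrec.sumCasesOn (f := fun y : (ℕ × List Entry) × Entry => y.2)
      (g := fun _ z => z.2) (h := fun y c => some (c % y.1.1)) Primrec.snd
      (Primrec.snd.comp Primrec.snd) ?_).of_eq fun y => by rcases y.2 with z | c <;> rfl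
    exact Primrec.option_some.comp (Primrec.nat_mod.comp Primrec.snd
      (Primrec.fst.comp (Primrec.fst.comp Primrec.fst)))
  exact h.of_eq fun y => by rcases y with ⟨y, z | c⟩ <;> rfl

lemma primrec_revealedEdges : Primrec revealedEdges := by
  refine Primrec.listFilterMap Primrec.id (g := fun (_ : List Entry) e => entryEdge e) ?_
  have h : Primrec entryEdge := by
    refine (Primrec.sumCasesOn (f := fun e : Entry => e)
      (g := fun _ z => z.2.map fun u => (z.1, u)) (h := fun _ _ => none) Primrec.id
      ?_ (Primrec.const none)).of_eq fun e => by rcases e with z | c <;> rfl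
    exact Primrec.option_map (Primrec.snd.comp Primrec.snd)
      ((Primrec.fst.comp (Primrec.snd.comp Primrec.fst)).pair Primrec.snd)
  exact h.comp Primrec.snd

lemma primrec_nextAction (w : ℕ) : Primrec₂ fun n tr => nextAction n w tr := by
  refine Primrec.ite ?_ ?_ ?_
  · exact Primrec.eq.comp (Primrec.nat_mod.comp (Primrec.list_length.comp Primrec.snd)
      (Primrec.const 2)) (Primrec.const 0)
  · exact Primrec.sumInr.comp (Primrec.sumInr.comp (Primrec.nat_sub.comp
      (Primrec.nat_mul.comp Primrec.fst (Primrec.const w)) (Primrec.const 1)))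
  · refine Primrec.sumInr.comp (Primrec.sumInl.comp ((Primrec.list_getD 0).comp
      (primrec_revealedVertices.comp Primrec.fst Primrec.snd) (Primrec.nat_div.comp ?_ Primrec.fst)))
    have h : Primrec fun e : Entry => Sum.elim (fun _ : ℕ × Option ℕ => 0) (id : ℕ → ℕ) e :=
      (Primrec.sumCasesOn (f := fun e : Entry => e) (g := fun _ _ => 0) (h := fun _ c => c)
        Primrec.id (Primrec.const 0) Primrec.snd).of_eq fun e => by rcases e with z | c <;> rfl
    refine h.comp ((Primrec.option_getD.comp (Primrec.list_head?.comp Primrec.snd)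
      (Primrec.const default)).of_eq fun z => ?_)
    rcases z.2 with _ | ⟨e, tr⟩ <;> rfl

lemma primrec_pow_const {f : α → ℕ} (hf : Primrec f) (j : ℕ) : Primrec fun a => f a ^ j := by
  induction j with
  | zero => exact (Primrec.const 1).of_eq fun a => by simp
  | succ j ih => exact (Primrec.nat_mul.comp ih hf).of_eq fun a => (pow_succ _ _).symm

lemma primrec_explorer {N : Params → ℕ} {w : ℕ} {verdict : Params × List Entry → Bool}
    (hN : Primrec N) (hv : Primrec verdict) : Primrec (explorer N w verdict) := by
  refine Primrec.ite ?_ (Primrec.sumInl.comp hv)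
    ((primrec_nextAction w).comp (Primrec.fst.comp Primrec.fst) Primrec.snd)
  exact Primrec.nat_le.comp (hN.comp Primrec.fst) (Primrec.list_length.comp Primrec.snd)

end Computability

/-! ### The tester -/

section Tester

/-- The number of lucky guesses that find a copy of a graph with `k` vertices. -/
def guesses (k : ℕ) : ℕ := k * (budget k k + 1)

/-- The number of exploration steps for graphs on `k` vertices, with weak reachability bound `M` and
proximity parameter at least `1 / d`. -/
def stepBound (k M d : ℕ) : ℕ :=
  2 * guesses k * (2 * (densityConst k M d * (2 * guesses k + 1)) ^ guesses k)

open Classical in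
/-- The tester for `H`-freeness. -/
noncomputable def hTester {k : ℕ} (H : SimpleGraph (Fin k)) (M : ℕ) : OracleAlgorithm :=
  explorer (fun x => stepBound k M (x.2.2 / x.2.1 + 1)) (2 * guesses k + 1)
    fun z => !decide (ContainsCopy H z.1.1 (revealedEdges z.2))

lemma computable_hTester {k : ℕ} (H : SimpleGraph (Fin k)) (M : ℕ) : Computable (hTester H M) := by
  classical
  refine (primrec_explorer ?_ ?_).to_comp
  · have hd : Primrec fun x : Params => x.2.2 / x.2.1 + 1 :=
      Primrec.succ.comp (Primrec.nat_div.comp (Primrec.snd.comp Primrec.snd)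
        (Primrec.fst.comp Primrec.snd))
    have hdens : Primrec fun x : Params => densityConst k M (x.2.2 / x.2.1 + 1) :=
      Primrec.succ.comp (Primrec.nat_mul.comp (Primrec.const _) hd)
    exact Primrec.nat_mul.comp (Primrec.const _) (Primrec.nat_mul.comp (Primrec.const 2)
      (primrec_pow_const (Primrec.nat_mul.comp hdens (Primrec.const _)) _))
  · refine Primrec.not.comp (PrimrecPred.decide ?_)
    exact (primrecPred_containsCopy H).comp
      (f := fun z : Params × List Entry => (z.1.1, revealedEdges z.2))
      ((Primrec.fst.comp Primrec.fst).pair (primrec_revealedEdges.comp Primrec.snd))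

variable {k n a b : ℕ} {H : SimpleGraph (Fin k)} {G : SimpleGraph (Fin n)} {M : ℕ}

lemma verdictProb_true_of_free (hG : H.Free G) :
    verdictProb (hTester H M) (n, a, b) G true = 1 := by
  refine le_antisymm (verdictProb_le_one true) ?_
  refine le_trans (prob_eq_one fun tr htr => ?_).ge (prob_verdict_le true)
  have hno : ¬ ContainsCopy H n (revealedEdges tr) := fun hc =>
    hG (hc.isContained (edges_of_mem_support_run _ htr))
  simpa using hno

lemma two_thirds_le_verdictProb_false (hn : 0 < n) (hkn : k ≤ n)
    (hreach : CanReach G (densityConst k M (b / a + 1))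
      (fun s => ∃ f : Fin k → Fin n,
        (∀ x y x' y', H.Adj x y → H.Adj x' y' → f x = f x' → x = x') ∧
        ∀ x y, H.Adj x y → s(f x, f y) ∈ s.2) (guesses k) (∅, ∅)) :
    2 / 3 ≤ verdictProb (hTester H M) (n, a, b) G false := by
  refine le_trans (two_thirds_le_prob (x := (n, a, b)) (w := 2 * guesses k + 1)
    (N := fun x => stepBound k M (x.2.2 / x.2.1 + 1)) rfl hn (Nat.succ_pos _)
    (good := fun tr => ContainsCopy H n (revealedEdges tr)) ?_ ?_ hreach (Nat.succ_pos _)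
    (Nat.le_succ _) rfl) (le_trans (prob_mono fun tr _ htr => ?_) (prob_verdict_le false))
  · intro e tr h
    refine h.mono ?_
    rw [revealedEdges, revealedEdges, List.filterMap_cons]
    split
    · exact List.Subset.refl _
    · exact List.subset_cons_self _ _
  · rintro tr m s hs ⟨f, hinj, hf⟩
    refine containsCopy_of_injOn hkn f hinj fun x y hxy => ?_
    obtain ⟨v, u, he, hvu⟩ := hs.2 _ (hf x y hxy)
    -- Known edges are unordered, but transcripts record them in the direction of the query.
    rcases Sym2.eq_iff.1 he with ⟨h1, h2⟩ | ⟨h1, h2⟩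
    · rw [h1, h2]
      exact Or.inl hvu
    · rw [h1, h2]
      exact Or.inr hvu
  · simpa using htr

/-- The integer `b / a + 1` exceeds 1/ε, so farness can be stated in natural numbers. -/
lemma card_le_of_isFar (ha : 0 < a) (hb : 0 < b) (h : IsFar (HFreeness H) ((a : ℝ) / b) G)
    (G' : SimpleGraph (Fin n)) (hG' : H.Free G') :
    n ≤ (b / a + 1) * (symmDiff G.edgeSet G'.edgeSet).ncard := by
  have h1 := h G' hG'
  generalize (symmDiff G.edgeSet G'.edgeSet).ncard = c at h1 ⊢
  have hb' : (0 : ℝ) < b := by exact_mod_cast hb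
  rw [div_mul_eq_mul_div, div_le_iff₀ hb'] at h1
  have h2 : a * n ≤ c * b := by exact_mod_cast h1
  have h3 : b ≤ a * (b / a + 1) := (Nat.lt_mul_div_succ b ha).le
  refine Nat.le_of_mul_le_mul_left (h2.trans ?_) ha
  calc c * b ≤ c * (a * (b / a + 1)) := Nat.mul_le_mul_left c h3
    _ = _ := by ring

theorem hTestable_of_universallyBoundedAdm {F : GraphFamily} (hF : UniversallyBoundedAdm F) :
    HTestable F := by
  obtain ⟨f, -, hf⟩ := hF
  intro k H
  refine ⟨hTester H ((f (k + 1) * (k + 1) + 1) ^ (k + 1)),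
    fun ε => stepBound k ((f (k + 1) * (k + 1) + 1) ^ (k + 1)) (⌊ε⁻¹⌋₊ + 1),
    computable_hTester H _, ?_⟩
  intro n a b hn ha hb G hG
  -- The tester sees `a` and `b`, but its step bound depends only on the ratio, as the query bound
  -- must.
  have hfloor : ⌊((a : ℚ) / b)⁻¹⌋₊ = b / a := by rw [inv_div, Nat.floor_div_eq_div]
  refine ⟨halts_explorer, ?_, verdictProb_true_of_free, fun hfar => ?_⟩
  · simp only [hfloor]
    exact queriesAtMost_explorer
  · have hfar' := card_le_of_isFar ha hb hfar
    have : Nonempty (Fin n) := ⟨⟨0, hn⟩⟩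
    -- Since εn > 0, a far graph contains `H`, which leaves room for its isolated vertices.
    have hkn : k ≤ n := by
      have hcont : ¬ H.Free G := by
        intro hfree
        have := hfar' G hfree
        simp only [symmDiff_self, Set.bot_eq_empty, Set.ncard_empty, mul_zero] at this
        omega
      obtain ⟨c⟩ := not_not.1 hcont
      simpa using Fintype.card_le_of_injective c c.injective
    refine two_thirds_le_verdictProb_false hn hkn ?_
    have hreach := canReach_copy_of_far H G (f (k + 1)) (b / a + 1) (Nat.succ_pos _)
      (by simpa using hf (k + 1) (Nat.succ_pos k) n G hG) (by simpa using hfar')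
    simpa only [Fintype.card_fin, guesses] using hreach

end Tester

end GraphTesting

theorem theorem1 (F : GraphTesting.GraphFamily) (hF : GraphTesting.UniversallyBoundedAdm F) :
    GraphTesting.HTestable F := by
  exact GraphTesting.hTestable_of_universallyBoundedAdm hF
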